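/- Let $n\ge 1$ and let $T^n=\mathbb{R}^n/(2\pi\mathbb{Z})^n$, and let all functions be complex-valued. For $u\in L^2(T^n)$ and $m\in\mathbb{Z}^n$ put $\hat u(m)=(2\pi)^{-n}\int_{T^n}u(x)e^{-i\langle m,x\rangle}\,dx$, and let $|m|$ be the Euclidean length of $m$. For $s>0$ let $\dot H^{s}(T^n)$ consist of those $u\in L^2(T^n)$ with $\|u\|_{\dot H^s}^2:=\sum_{m\in\mathbb{Z}^n}|m|^{2s}|\hat u(m)|^2<\infty$. Let $(-\Delta)^{s}$ and $\bar{\mathcal R}_j$ ($1\le j\le n$) be the Fourier multiplier operators with symbols $|m|^{2s}$ and $\overline{i\,m_j/|m|}=-i\,m_j/|m|$ (equal to $0$ at $m=0$), i.e. $$(-\Delta)^{s}u=\sum_{m\in\mathbb{Z}^n}|m|^{2s}\,\hat u(m)\,e^{i\langle m,\cdot\rangle},\qquad \bar{\mathcal R}_ju=\sum_{m\in\mathbb{Z}^n\setminus\{0\}}\overline{\Big(i\frac{m_j}{|m|}\Big)}\,\hat u(m)\,e^{i\langle m,\cdot\rangle}.$$ Then there is a constant $C>0$ depending only on $n$ such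 that for every $g\in L^2(T^n)$ with $\frac{1}{(2\pi)^n}\int_{T^n}g\,dx=0$ there exist $f_0,f_1,\dots,f_n\in \dot H^{n/2}(T^n)\cap C^0(T^n)$ with $$g=(-\Delta)^{n/4}f_0+\sum_{j=1}^n(-\Delta)^{n/4}\bar{\mathcal R}_jf_j$$ (an equality in $L^2(T^n)$) and $$\sum_{j=0}^n\|f_j\|_{\dot H^{n/2}\cap L^\infty}\le C\,\|g\|_{L^2},\qquad\text{where } \|f\|_{\dot H^{n/2}\cap L^\infty}:=\|f\|_{\dot H^{n/2}}+\|f\|_{L^\infty}.$$ -/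

import Mathlib

open MeasureTheory
open scoped Real ENNReal ComplexConjugate

noncomputable section

namespace TorusPDE

instance fact_two_pi_pos : Fact (0 < 2 * π) := ⟨Real.two_pi_pos⟩

/-- The torus `Tⁿ = (ℝ / 2πℤ)ⁿ`. Its `volume` is the product Lebesgue measure `dx`,
of total mass `(2π)ⁿ`. -/
abbrev Torus (n : ℕ) : Type := Fin n → AddCircle (2 * π)

/-- The complex Hilbert space `L²(Tⁿ)`, with respect to `dx`. -/
abbrev L2 (n : ℕ) : Type := Lp ℂ 2 (volume : Measure (Torus n))

variable {n : ℕ}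

/-- The character `x ↦ exp (i ⟨m, x⟩)` of the torus, see `character_coe`. -/
def character (m : Fin n → ℤ) : C(Torus n, ℂ) where
  toFun x := ∏ i, fourier (m i) (x i)
  continuous_toFun := by fun_prop

theorem character_coe (m : Fin n → ℤ) (x : Fin n → ℝ) :
    character m (fun i => (x i : AddCircle (2 * π))) =
      Complex.exp (Complex.I * ∑ i, (m i : ℂ) * (x i : ℂ)) := by
  have hpi : (π : ℂ) ≠ 0 := by exact_mod_cast Real.pi_ne_zero
  simp only [character, ContinuousMap.coe_mk, fourier_coe_apply, Finset.mul_sum, Complex.exp_sum]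
  refine Finset.prod_congr rfl fun i _ => ?_
  congr 1
  push_cast
  field_simp

/-- The class in `L²(Tⁿ)` of a continuous function on the torus. -/
def ofContinuous (f : C(Torus n, ℂ)) : L2 n := ContinuousMap.toLp (E := ℂ) 2 volume ℂ f

/-- The Fourier coefficient `û(m) = (2π)⁻ⁿ ∫ u(x) exp (-i ⟨m, x⟩) dx`. -/
def coeff (u : L2 n) (m : Fin n → ℤ) : ℂ :=
  ((1 / (2 * π) ^ n : ℝ) : ℂ) * ∫ x, u x * character (-m) x

/-- The Euclidean length `|m|` of a frequency `m ∈ ℤⁿ`. -/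
def freqNorm (m : Fin n → ℤ) : ℝ := Real.sqrt (∑ i, (m i : ℝ) ^ 2)

/-- Membership in the homogeneous Sobolev space `Ḣˢ(Tⁿ)`, for `s > 0`:
`∑ |m|²ˢ |û(m)|² < ∞`. -/
def MemHomSobolev (s : ℝ) (u : L2 n) : Prop :=
  Summable fun m : Fin n → ℤ => freqNorm m ^ (2 * s) * ‖coeff u m‖ ^ 2

/-- The (semi)norm `‖u‖_{Ḣˢ} = (∑ |m|²ˢ |û(m)|²)^{1/2}` of `u ∈ Ḣˢ(Tⁿ)`, for `s > 0`. -/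
def homSobolevNorm (s : ℝ) (u : L2 n) : ℝ :=
  Real.sqrt (∑' m : Fin n → ℤ, freqNorm m ^ (2 * s) * ‖coeff u m‖ ^ 2)

/-- The Fourier multiplier operator with symbol `a`: the sum in `L²(Tⁿ)` of the series
`∑ a(m) û(m) exp (i ⟨m, ·⟩)`. By `summable_multiplier` the series converges in `L²(Tⁿ)` as soon as
its coefficients are square summable, and by `coeff_multiplier` the result then has Fourier
coefficients `a(m) û(m)`. -/
def multiplier (a : (Fin n → ℤ) → ℂ) (u : L2 n) : L2 n :=
  ∑' m : Fin n → ℤ, (a m * coeff u m) • ofContinuous (character m)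

/-- The symbol `|m|²ˢ` of `(-Δ)ˢ`. -/
def fracLaplacianSymbol (s : ℝ) (m : Fin n → ℤ) : ℂ := ((freqNorm m ^ (2 * s) : ℝ) : ℂ)

/-- The symbol `i mⱼ / |m|` of the Riesz transform `𝓡ⱼ` (it vanishes at `m = 0`). -/
def rieszSymbol (j : Fin n) (m : Fin n → ℤ) : ℂ := Complex.I * ((m j / freqNorm m : ℝ) : ℂ)

/-- The fractional Laplacian `(-Δ)ˢ`, `s > 0`, on its domain `Ḣ²ˢ(Tⁿ) ∩ L²(Tⁿ)`, with values in
`L²(Tⁿ)`. -/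
def fracLaplacian (s : ℝ) (u : L2 n) : L2 n := multiplier (fracLaplacianSymbol s) u

/-- The conjugate Riesz transform: the multiplier operator whose symbol is the complex conjugate
`-i mⱼ / |m|` of that of `𝓡ⱼ`. It is the `L²` adjoint of `𝓡ⱼ`. -/
def rieszConj (j : Fin n) (u : L2 n) : L2 n := multiplier (fun m => conj (rieszSymbol j m)) u

/-! ### The series defining the operators converge -/

theorem integral_fourier (k : ℤ) :
    ∫ x : AddCircle (2 * π), fourier k x = if k = 0 then ((2 * π : ℝ) : ℂ) else 0 := by
  have h := orthonormal_iff_ite.mp (orthonormal_fourier (T := 2 * π)) 0 k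
  rw [ContinuousMap.inner_toLp] at h
  simp only [← fourier_neg, ← fourier_add, neg_zero, add_zero] at h
  rw [AddCircle.volume_eq_smul_haarAddCircle, integral_smul_measure, h]
  by_cases hk : k = 0
  · simp [hk, Real.pi_pos.le]
  · simp [hk, Ne.symm hk]

theorem integral_character (k : Fin n → ℤ) :
    ∫ x, character k x = if k = 0 then (((2 * π) ^ n : ℝ) : ℂ) else 0 := by
  simp only [character, ContinuousMap.coe_mk]
  rw [integral_fintype_prod_volume_eq_prod (fun i (x : AddCircle (2 * π)) => (fourier (k i) x : ℂ))]
  simp only [integral_fourier]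
  split_ifs with h
  · simp [h]
  · obtain ⟨i, hi⟩ := Function.ne_iff.mp h
    exact Finset.prod_eq_zero (Finset.mem_univ i) (if_neg hi)

theorem character_neg (m : Fin n → ℤ) (x : Torus n) : character (-m) x = conj (character m x) := by
  simp [character, map_prod]

theorem inner_character (m k : Fin n → ℤ) :
    inner ℂ (ofContinuous (character m)) (ofContinuous (character k)) =
      if m = k then (((2 * π) ^ n : ℝ) : ℂ) else 0 := by
  rw [ofContinuous, ofContinuous, ContinuousMap.inner_toLp]
  have : ∀ x : Torus n, character k x * conj (character m x) = character (k - m) x := fun x => by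
    rw [← character_neg, sub_eq_add_neg]
    simp [character, Finset.prod_mul_distrib]
  simp only [this, integral_character, sub_eq_zero, eq_comm]

theorem coeff_eq_inner (u : L2 n) (m : Fin n → ℤ) :
    coeff u m = ((1 / (2 * π) ^ n : ℝ) : ℂ) * inner ℂ (ofContinuous (character m)) u := by
  rw [coeff, MeasureTheory.L2.inner_def]
  congr 1
  refine integral_congr_ae ?_
  filter_upwards [ContinuousMap.coeFn_toLp (𝕜 := ℂ) (p := 2) volume (character m)] with x hx
  rw [ofContinuous, hx, RCLike.inner_apply, character_neg]

theorem orthogonalFamily_character :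
    OrthogonalFamily ℂ (fun m : Fin n → ℤ => ℂ ∙ (ofContinuous (character m)))
      (fun m => (ℂ ∙ (ofContinuous (character m))).subtypeₗᵢ) := by
  intro m k h v w
  obtain ⟨a, ha⟩ := Submodule.mem_span_singleton.mp v.2
  obtain ⟨b, hb⟩ := Submodule.mem_span_singleton.mp w.2
  simp [← ha, ← hb, inner_smul_left, inner_smul_right, inner_character, h]

theorem norm_sq_character (m : Fin n → ℤ) : ‖ofContinuous (character m)‖ ^ 2 = (2 * π) ^ n := by
  have h := inner_character m m
  rw [inner_self_eq_norm_sq_to_K, if_pos rfl] at h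
  exact Complex.ofReal_injective (by simpa using h)

theorem summable_series {c : (Fin n → ℤ) → ℂ} (hc : Summable fun m => ‖c m‖ ^ 2) :
    Summable fun m : Fin n → ℤ => c m • ofContinuous (character m) := by
  refine (orthogonalFamily_character.summable_iff_norm_sq_summable
    (fun m => ⟨c m • ofContinuous (character m),
      Submodule.smul_mem _ _ (Submodule.mem_span_singleton_self _)⟩)).mpr ?_
  simpa [norm_smul, mul_pow, norm_sq_character] using hc.mul_right ((2 * π) ^ n)

theorem summable_multiplier {a : (Fin n → ℤ) → ℂ} {u : L2 n}
    (h : Summable fun m => ‖a m * coeff u m‖ ^ 2) :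
    Summable fun m : Fin n → ℤ => (a m * coeff u m) • ofContinuous (character m) :=
  summable_series h

theorem coeff_multiplier {a : (Fin n → ℤ) → ℂ} {u : L2 n}
    (h : Summable fun m => ‖a m * coeff u m‖ ^ 2) (k : Fin n → ℤ) :
    coeff (multiplier a u) k = a k * coeff u k := by
  have hpi : ((2 * π : ℝ) : ℂ) ^ n ≠ 0 :=
    pow_ne_zero _ (by exact_mod_cast Real.two_pi_pos.ne')
  have h1 := (summable_multiplier h).hasSum.mapL (innerSL ℂ (ofContinuous (character k)))
  have h2 : HasSum (fun m => innerSL ℂ (ofContinuous (character k))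
      ((a m * coeff u m) • ofContinuous (character m)))
      ((a k * coeff u k) * (((2 * π) ^ n : ℝ) : ℂ)) := by
    convert hasSum_single k ?_ using 1
    · rw [innerSL_apply_apply, inner_smul_right, inner_character, if_pos rfl]
    · intro m hm
      simp [inner_character, Ne.symm hm]
  rw [coeff_eq_inner, multiplier, ← innerSL_apply_apply ℂ, h1.unique h2]
  push_cast at hpi ⊢
  field_simp

theorem summable_sq_coeff (u : L2 n) : Summable fun m => ‖coeff u m‖ ^ 2 := by
  have hp : (0 : ℝ) < (2 * π) ^ n := pow_pos Real.two_pi_pos _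
  have ho : Orthonormal ℂ (fun m : Fin n → ℤ =>
      ((1 / Real.sqrt ((2 * π) ^ n) : ℝ) : ℂ) • ofContinuous (character m)) := by
    rw [orthonormal_iff_ite]
    intro m k
    rw [inner_smul_left, inner_smul_right, inner_character]
    split_ifs
    · rw [Complex.conj_ofReal]
      norm_cast
      have := Real.mul_self_sqrt hp.le
      have h0 := (Real.sqrt_pos.mpr hp).ne'
      field_simp
      rw [sq, this]
    · simp
  refine ((ho.inner_products_summable u).mul_left (1 / (2 * π) ^ n)).congr fun m => ?_
  rw [coeff_eq_inner, inner_smul_left, norm_mul, norm_mul, Complex.conj_ofReal, Complex.norm_real,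
    Complex.norm_real, Real.norm_of_nonneg (by positivity), Real.norm_of_nonneg (by positivity)]
  generalize (2 * π) ^ n = p at hp
  rw [mul_pow, mul_pow, div_pow, Real.sq_sqrt hp.le]
  ring

theorem freqNorm_nonneg (m : Fin n → ℤ) : 0 ≤ freqNorm m := Real.sqrt_nonneg _

theorem norm_rieszSymbol_le (j : Fin n) (m : Fin n → ℤ) : ‖rieszSymbol j m‖ ≤ 1 := by
  rw [rieszSymbol, norm_mul, Complex.norm_I, one_mul, Complex.norm_real, Real.norm_eq_abs, abs_div,
    abs_of_nonneg (freqNorm_nonneg m)]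
  refine div_le_one_of_le₀ (Real.abs_le_sqrt ?_) (freqNorm_nonneg m)
  exact Finset.single_le_sum (f := fun i => (m i : ℝ) ^ 2) (fun i _ => sq_nonneg _)
    (Finset.mem_univ j)

/-- `(-Δ)ˢ u` has Fourier coefficients `|m|²ˢ û(m)` for every `u ∈ Ḣ²ˢ`. -/
theorem coeff_fracLaplacian {s : ℝ} {u : L2 n} (hu : MemHomSobolev (2 * s) u) (m : Fin n → ℤ) :
    coeff (fracLaplacian s u) m = ((freqNorm m ^ (2 * s) : ℝ) : ℂ) * coeff u m := by
  refine coeff_multiplier (hu.congr fun k => ?_) m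
  rw [fracLaplacianSymbol, norm_mul, mul_pow, Complex.norm_real,
    Real.norm_of_nonneg (Real.rpow_nonneg (freqNorm_nonneg k) _),
    ← Real.rpow_mul_natCast (freqNorm_nonneg k)]
  congr 2
  push_cast
  ring

/-- The conjugate Riesz transform has Fourier coefficients `-i mⱼ / |m| û(m)` on all of `L²`. -/
theorem coeff_rieszConj (j : Fin n) (u : L2 n) (m : Fin n → ℤ) :
    coeff (rieszConj j u) m = conj (rieszSymbol j m) * coeff u m := by
  refine coeff_multiplier ((summable_sq_coeff u).of_nonneg_of_le (fun _ => sq_nonneg _)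
    fun k => ?_) m
  rw [norm_mul, RCLike.norm_conj]
  gcongr
  exact mul_le_of_le_one_left (norm_nonneg _) (norm_rieszSymbol_le j k)

/-- The conjugate Riesz transforms preserve `Ḣˢ`, so that `(-Δ)ˢ` may be applied after them. -/
theorem MemHomSobolev.rieszConj {s : ℝ} {u : L2 n} (hu : MemHomSobolev s u) (j : Fin n) :
    MemHomSobolev s (rieszConj j u) := by
  refine Summable.of_nonneg_of_le (fun m => ?_) (fun m => ?_) hu
  · exact mul_nonneg (Real.rpow_nonneg (freqNorm_nonneg m) _) (sq_nonneg _)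
  · rw [coeff_rieszConj, norm_mul, RCLike.norm_conj]
    refine mul_le_mul_of_nonneg_left ?_ (Real.rpow_nonneg (freqNorm_nonneg m) _)
    gcongr
    exact mul_le_of_le_one_left (norm_nonneg _) (norm_rieszSymbol_le j m)

end TorusPDE

end

noncomputable section

namespace TorusPDE

/-! The proof is by duality. On Fourier coefficients at nonzero frequencies the right-hand side is a
bounded operator `system n` from `n + 1` copies of the Banach space `Ḣ^{n/2} ∩ C⁰` to `ℓ²`. It is
onto, with control of preimages, once its transpose is bounded below
(`exists_preimage_norm_le_of_dual_bound`).

Let `φ` be a functional on `ℓ²` with coefficients `p(m)`, and let `ε` be the norm of `φ ∘ system n`.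
By Hahn–Banach each component of this composite extends to `ℓ² × C⁰`, so it splits into `aᵢ ∈ ℓ²`
and `μᵢ ∈ (C⁰)*`, all of norm at most `ε`. Testing on characters gives `p = a₀ + |m|^{-n/2} μ₀(χₘ)`
and `p rⱼ = aⱼ + |m|^{-n/2} μⱼ(χₘ)`, where `rⱼ = -i mⱼ/|m|`.

Since `∑ |rⱼ|² = 1`, up to `ℓ²` errors `|p|²` is controlled by the real part of `∑ⱼ rⱼ |m|^{-n}
μ₀(χₘ) conj μⱼ(χₘ)`. The symbol `mⱼ/|m|^{n+1}` is odd and homogeneous of degree `-n`, so its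
convolution kernel should be bounded, whereas that of `|m|^{-n}` diverges logarithmically. A bounded
kernel gives a bounded bilinear form on `(C⁰)*` (`norm_bilinear_le`), hence `‖p‖² ≲ ε²`.

To make this elementary, `|m|^{-(n+1)}` is replaced by the comparable `dyadicWeight`, a finite sum
of product Poisson symbols. The kernel bound (`norm_tsum_kernel_le`) and the upper bound on the
weight both follow from the telescoping of `t/(1+t)` along dyadic scales (`sub_div_one_add_le`). The
estimates are uniform in the truncation `L`. -/

/-! ### Surjectivity from a lower bound on the transpose -/

/-- Otherwise Hahn–Banach separates `y` from this closed convex set by some `φ` and a level `u`.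
Since the set is the closed image of a ball of radius `c‖y‖`, `c‖y‖‖φ ∘ T‖ ≤ u < Re φ(y) ≤ ‖φ‖‖y‖`,
against the hypothesis. -/
theorem mem_closure_image_closedBall_of_dual_bound {F H : Type*}
    [NormedAddCommGroup F] [NormedSpace ℂ F] [NormedAddCommGroup H] [NormedSpace ℂ H]
    (T : F →L[ℂ] H) {c : ℝ} (hc : 0 < c)
    (h : ∀ φ : H →L[ℂ] ℂ, ‖φ‖ ≤ c * ‖φ.comp T‖) (y : H) :
    y ∈ closure (T '' Metric.closedBall 0 (c * ‖y‖)) := by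
  rcases eq_or_ne y 0 with rfl | hy
  · exact subset_closure ⟨0, by simp, by simp⟩
  have hR : 0 < c * ‖y‖ := mul_pos hc (norm_pos_iff.mpr hy)
  set R := c * ‖y‖ with hRdef
  let _ : NormedSpace ℝ H := NormedSpace.restrictScalars ℝ ℂ H
  let _ : NormedSpace ℝ F := NormedSpace.restrictScalars ℝ ℂ F
  let _ : IsScalarTower ℝ ℂ H := IsScalarTower.restrictScalars ℝ ℂ H
  let _ : IsScalarTower ℝ ℂ F := IsScalarTower.restrictScalars ℝ ℂ F
  by_contra hmem
  have hconv : Convex ℝ (closure (T '' Metric.closedBall 0 R)) := by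
    refine Convex.closure ?_
    exact (convex_closedBall (0 : F) R).linear_image (T.toLinearMap.restrictScalars ℝ)
  obtain ⟨φ, u, h1, h2⟩ :=
    RCLike.geometric_hahn_banach_closed_point (𝕜 := ℂ) hconv isClosed_closure hmem
  -- The separation controls only the real part; the ball is invariant under multiplication by `θ`,
  -- which upgrades this to the modulus.
  have hball : ∀ x : F, ‖x‖ ≤ R → ‖φ (T x)‖ ≤ u := by
    intro x hx
    obtain ⟨θ, hθ, hθx⟩ : ∃ θ : ℂ, ‖θ‖ ≤ 1 ∧ θ * φ (T x) = ‖φ (T x)‖ := by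
      rcases eq_or_ne (φ (T x)) 0 with h0 | h0
      · exact ⟨1, by simp, by simp [h0]⟩
      · have hn : (‖φ (T x)‖ : ℂ) ≠ 0 := by simpa using h0
        refine ⟨conj (φ (T x)) / ‖φ (T x)‖, ?_, ?_⟩
        · rw [norm_div, RCLike.norm_conj, Complex.norm_real, norm_norm]
          exact div_self_le_one _
        · rw [div_mul_eq_mul_div, mul_comm, Complex.mul_conj, Complex.normSq_eq_norm_sq]
          push_cast
          field_simp
    have := h1 (T (θ • x)) (subset_closure ⟨θ • x, by
      simp only [Metric.mem_closedBall, dist_zero_right, norm_smul]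
      exact (mul_le_of_le_one_left (norm_nonneg _) hθ).trans hx, rfl⟩)
    rw [map_smul, map_smul, smul_eq_mul, hθx] at this
    simpa using this.le
  have hop : ‖φ.comp T‖ ≤ u / R := by
    have hu : 0 ≤ u := (norm_nonneg _).trans (hball 0 (by simpa using hR.le))
    refine ContinuousLinearMap.opNorm_le_bound _ (by positivity) fun x => ?_
    rcases eq_or_ne x 0 with rfl | hx
    · simp
    have hx' := norm_pos_iff.mpr hx
    have := hball (((R / ‖x‖ : ℝ) : ℂ) • x) (by
      rw [norm_smul, Complex.norm_real, Real.norm_of_nonneg (by positivity)]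
      field_simp; rfl)
    rw [map_smul, map_smul, norm_smul, Complex.norm_real,
      Real.norm_of_nonneg (by positivity)] at this
    rw [ContinuousLinearMap.comp_apply]
    rw [div_mul_eq_mul_div, div_le_iff₀ hx'] at this
    rw [div_mul_eq_mul_div, le_div_iff₀ hR]
    linarith
  have h3 : RCLike.re (φ y) ≤ ‖φ‖ * ‖y‖ := (RCLike.re_le_norm _).trans (φ.le_opNorm y)
  have h4 : ‖φ‖ * ‖y‖ ≤ (c * ‖φ.comp T‖) * ‖y‖ := by gcongr; exact h φ
  have h5 : (c * ‖φ.comp T‖) * ‖y‖ ≤ u := by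
    rw [le_div_iff₀ hR] at hop
    rw [hRdef] at hop
    linarith
  linarith

/-- A bounded operator whose transpose is bounded below is onto, with control of preimages. -/
theorem exists_preimage_norm_le_of_dual_bound {F H : Type*}
    [NormedAddCommGroup F] [NormedSpace ℂ F] [CompleteSpace F]
    [NormedAddCommGroup H] [NormedSpace ℂ H]
    (T : F →L[ℂ] H) {c : ℝ} (hc : 0 < c)
    (h : ∀ φ : H →L[ℂ] ℂ, ‖φ‖ ≤ c * ‖φ.comp T‖) (y : H) :
    ∃ x, T x = y ∧ ‖x‖ ≤ 2 * c * ‖y‖ := by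
  have approx : ∀ y : H, ∃ x, ‖y - T x‖ ≤ ‖y‖ / 2 ∧ ‖x‖ ≤ c * ‖y‖ := by
    intro y
    rcases eq_or_ne y 0 with rfl | hy
    · exact ⟨0, by simp⟩
    obtain ⟨_, ⟨x, hx, rfl⟩, hd⟩ := Metric.mem_closure_iff.mp
      (mem_closure_image_closedBall_of_dual_bound T hc h y) (‖y‖ / 2)
      (half_pos (norm_pos_iff.mpr hy))
    exact ⟨x, by simpa [dist_eq_norm] using hd.le, by simpa using hx⟩
  choose G hG1 hG2 using approx
  -- `r k` is the residual after `k` corrections. It halves each time, so the corrections form a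
  -- geometric series, whence the factor `2`.
  let r : ℕ → H := fun k => Nat.rec y (fun _ z => z - T (G z)) k
  have hr0 : r 0 = y := rfl
  have hrs : ∀ k, r (k + 1) = r k - T (G (r k)) := fun _ => rfl
  have hr : ∀ k, ‖r k‖ ≤ ‖y‖ * (1 / 2) ^ k := by
    intro k
    induction k with
    | zero => simp [hr0]
    | succ k ih =>
      rw [hrs, pow_succ]
      have := hG1 (r k)
      linarith
  have hx : ∀ k, ‖G (r k)‖ ≤ c * ‖y‖ * (1 / 2) ^ k := fun k =>
    (hG2 _).trans (by rw [mul_assoc]; gcongr; exact hr k)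
  have hgeo : HasSum (fun k : ℕ => c * ‖y‖ * (1 / 2 : ℝ) ^ k) (c * ‖y‖ * 2) :=
    hasSum_geometric_two.mul_left _
  have hsum : Summable fun k => G (r k) := .of_norm_bounded hgeo.summable hx
  refine ⟨∑' k, G (r k), ?_, ?_⟩
  · have hT := (hsum.hasSum.mapL T).tendsto_sum_nat
    have hp : ∀ N, ∑ k ∈ Finset.range N, T (G (r k)) = y - r N := by
      intro N
      induction N with
      | zero => simp [hr0]
      | succ N ih => rw [Finset.sum_range_succ, ih, hrs]; abel
    simp only [hp] at hT
    have hr' : Filter.Tendsto r Filter.atTop (nhds 0) := by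
      refine squeeze_zero_norm hr ?_
      simpa using (tendsto_pow_atTop_nhds_zero_of_lt_one (r := (1 / 2 : ℝ)) (by norm_num)
        (by norm_num)).const_mul ‖y‖
    have := tendsto_nhds_unique hT (tendsto_const_nhds.sub hr')
    simpa using this
  · have := tsum_of_norm_bounded hgeo hx
    linarith

/-! ### Product series over `ℤⁿ` -/

theorem hasSum_mul_prod {β : Type*} (f : ℤ → ℂ) (g : β → ℂ) (hf : Summable fun k => ‖f k‖)
    (hg : Summable fun k => ‖g k‖) :
    (Summable fun q : ℤ × β => ‖f q.1 * g q.2‖) ∧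
      HasSum (fun q : ℤ × β => f q.1 * g q.2) ((∑' k, f k) * ∑' k, g k) := by
  have hs : Summable fun q : ℤ × β => ‖f q.1 * g q.2‖ := Summable.mul_norm hf hg
  exact ⟨hs, hf.of_norm.hasSum.mul hg.of_norm.hasSum hs.of_norm⟩
theorem hasSum_pi_prod (n : ℕ) (f : Fin n → ℤ → ℂ) (hf : ∀ i, Summable fun k => ‖f i k‖) :
    (Summable fun m : Fin n → ℤ => ‖∏ i, f i (m i)‖) ∧
      HasSum (fun m : Fin n → ℤ => ∏ i, f i (m i)) (∏ i, ∑' k, f i k) := by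
  induction n with
  | zero => exact ⟨(hasSum_fintype _).summable, by simp⟩
  | succ n ih =>
    obtain ⟨h1, h2⟩ := ih (fun i => f i.succ) fun i => hf i.succ
    let e : ℤ × (Fin n → ℤ) ≃ (Fin (n + 1) → ℤ) := Fin.consEquiv fun _ => ℤ
    have he : ∀ q : ℤ × (Fin n → ℤ), ∏ i, f i (e q i) = f 0 q.1 * ∏ i, f i.succ (q.2 i) := by
      intro q
      rw [Fin.prod_univ_succ]
      simp [e, Fin.consEquiv]
    clear_value e
    have h1' : Summable fun m : Fin n → ℤ => ‖∏ i, f i.succ (m i)‖ := h1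
    have h2' : HasSum (fun m : Fin n → ℤ => ∏ i, f i.succ (m i)) (∏ i : Fin n, ∑' k, f i.succ k) := h2
    have hmul := hasSum_mul_prod (f 0) (fun q : Fin n → ℤ => ∏ i, f i.succ (q i))
    obtain ⟨h3, h4⟩ := hmul (hf 0) h1'
    rw [h2'.tsum_eq] at h4
    constructor
    · rw [← e.summable_iff]
      exact h3.congr fun q => by rw [← he q]; rfl
    · rw [← e.hasSum_iff, Fin.prod_univ_succ]
      exact h4.congr_fun he

/-! ### The Poisson kernel on the circle and its derivative -/

theorem hasSum_pow_natAbs {r : ℝ} (h0 : 0 ≤ r) (h1 : r < 1) :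
    HasSum (fun k : ℤ => r ^ k.natAbs) ((1 + r) / (1 - r)) := by
  have ha := hasSum_geometric_of_lt_one h0 h1
  have := HasSum.of_nat_of_neg_add_one (f := fun k : ℤ => r ^ k.natAbs) (m := (1 - r)⁻¹)
    (m' := (1 - r)⁻¹ * r) (by simpa using ha) (by
      refine (ha.mul_right r).congr_fun fun k => ?_
      rw [← pow_succ]
      congr 1)
  convert this using 1
  have : 1 - r ≠ 0 := by linarith
  field_simp

theorem norm_pow_natAbs_mul_fourier (r : ℝ) (h0 : 0 ≤ r) (x : AddCircle (2 * π)) (k : ℤ) :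
    ‖((r ^ k.natAbs : ℝ) : ℂ) * fourier k x‖ = r ^ k.natAbs := by
  rw [norm_mul, fourier_apply, Circle.norm_coe, mul_one, Complex.norm_real,
    Real.norm_of_nonneg (by positivity)]

theorem summable_norm_poisson {r : ℝ} (h0 : 0 ≤ r) (h1 : r < 1) (x : AddCircle (2 * π)) :
    Summable fun k : ℤ => ‖((r ^ k.natAbs : ℝ) : ℂ) * fourier k x‖ := by
  simp_rw [norm_pow_natAbs_mul_fourier r h0]
  exact (hasSum_pow_natAbs h0 h1).summable

theorem norm_tsum_poisson_le {r : ℝ} (h0 : 0 ≤ r) (h1 : r < 1) (x : AddCircle (2 * π)) :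
    ‖∑' k : ℤ, ((r ^ k.natAbs : ℝ) : ℂ) * fourier k x‖ ≤ 2 / (1 - r) := by
  refine (tsum_of_norm_bounded (hasSum_pow_natAbs h0 h1)
    fun k => (norm_pow_natAbs_mul_fourier r h0 x k).le).trans ?_
  have : 0 < 1 - r := by linarith
  gcongr
  linarith

theorem summable_norm_conjPoisson {r : ℝ} (h0 : 0 ≤ r) (h1 : r < 1) (x : AddCircle (2 * π)) :
    Summable fun k : ℤ => ‖(k : ℂ) * (((r ^ k.natAbs : ℝ) : ℂ) * fourier k x)‖ := by
  have h : Summable fun k : ℕ => (k : ℝ) * r ^ k := by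
    simpa using summable_pow_mul_geometric_of_norm_lt_one 1 (r := r)
      (by rwa [Real.norm_of_nonneg h0])
  simp_rw [norm_mul _ (((_ : ℝ) : ℂ) * _), norm_pow_natAbs_mul_fourier r h0]
  refine Summable.of_nat_of_neg ?_ ?_ <;> simpa using h

theorem fourier_natCast (x : AddCircle (2 * π)) (k : ℕ) :
    (fourier (k : ℤ) x : ℂ) = (fourier 1 x : ℂ) ^ k := by
  simp [fourier_apply, AddCircle.toCircle_nsmul]

theorem hasSum_conjPoisson {r : ℝ} (h0 : 0 ≤ r) (h1 : r < 1) (x : AddCircle (2 * π)) :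
    HasSum (fun k : ℤ => (k : ℂ) * (((r ^ k.natAbs : ℝ) : ℂ) * fourier k x))
      ((r * fourier 1 x) / (1 - r * fourier 1 x) ^ 2 -
        conj (r * fourier 1 x : ℂ) / (1 - conj (r * fourier 1 x : ℂ)) ^ 2) := by
  have hz : ‖(r * fourier 1 x : ℂ)‖ < 1 := by
    rw [norm_mul, fourier_apply, Circle.norm_coe, mul_one, Complex.norm_real,
      Real.norm_of_nonneg h0]
    exact h1
  have ha := hasSum_coe_mul_geometric_of_norm_lt_one hz
  have hb := (hasSum_coe_mul_geometric_of_norm_lt_one (𝕜 := ℂ)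
    (r := conj (r * fourier 1 x : ℂ)) (by rwa [RCLike.norm_conj])).neg
  have h := HasSum.of_nat_of_neg (f := fun k : ℤ => (k : ℂ) * (((r ^ k.natAbs : ℝ) : ℂ) *
    fourier k x)) (ha.congr_fun fun k => ?_) (hb.congr_fun fun k => ?_)
  · rw [sub_eq_add_neg]
    simpa only [Int.cast_zero, zero_mul, sub_zero] using h
  · rw [fourier_natCast, Int.natAbs_natCast, mul_pow]
    push_cast
    rfl
  · rw [fourier_neg, fourier_natCast, Int.natAbs_neg, Int.natAbs_natCast, map_mul, mul_pow,
      Complex.conj_ofReal, map_pow]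
    push_cast
    ring

/-- Over the common denominator the numerator factors as `(z - conj z)(1 - |z|²)`. Both factors are
needed: one vanishes with `Im z`, the other as `|z| → 1`. -/
theorem conjPoisson_closed_form {z : ℂ} (hz : 1 - z ≠ 0) :
    z / (1 - z) ^ 2 - conj z / (1 - conj z) ^ 2 =
      ((2 * z.im * (1 - ‖z‖ ^ 2) / (‖1 - z‖ ^ 2) ^ 2 : ℝ) : ℂ) * Complex.I := by
  have hz' : 1 - conj z ≠ 0 := by
    have := (map_ne_zero (starRingEnd ℂ)).mpr hz
    simpa using this
  have e1 : ((‖z‖ ^ 2 : ℝ) : ℂ) = z * conj z := by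
    rw [Complex.mul_conj, Complex.normSq_eq_norm_sq]
  have e2 : ((‖1 - z‖ ^ 2 : ℝ) : ℂ) = (1 - z) * (1 - conj z) := by
    rw [← Complex.normSq_eq_norm_sq, ← Complex.mul_conj]; simp
  have e3 : ((2 * z.im : ℝ) : ℂ) * Complex.I = z - conj z := by
    rw [Complex.sub_conj]
  rw [Complex.ofReal_div, Complex.ofReal_mul, Complex.ofReal_sub, Complex.ofReal_pow (‖1 - z‖ ^ 2),
    e1, e2, div_mul_eq_mul_div, mul_right_comm, e3]
  push_cast
  field_simp
  ring

/-- A quantity below `min(u, 1/u)` is dominated by the increment of `t/(1+t)` from `u` to `2u`.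
Summed over dyadic `u`, such increments telescope to at most `1`. -/
theorem sub_div_one_add_le {u v : ℝ} (hv : 0 ≤ v) (h1 : v ≤ u) (h2 : u * v ≤ 1) :
    v ≤ 6 * (2 * u / (1 + 2 * u) - u / (1 + u)) := by
  have hu : 0 ≤ u := hv.trans h1
  have hv1 : v ≤ 1 := by nlinarith
  have : 2 * u / (1 + 2 * u) - u / (1 + u) = u / ((1 + u) * (1 + 2 * u)) := by
    field_simp
    ring
  rw [this, mul_div_assoc', le_div_iff₀ (by positivity)]
  nlinarith [mul_nonneg hu hv, mul_nonneg hu (sub_nonneg.mpr hv1), mul_nonneg hu (sub_nonneg.mpr h2)]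

/-- With `s = |sin x|` and `D = |1 - z|²`, the closed form bounds the left side by `4 d³ s / D²`.
Since `D` dominates both `d²` and `s²`, `d³ s / D²` is at most `min(s/d, d/s)`, and the telescoping
bound applies; `24 = 4 · 6`. -/
theorem norm_tsum_conjPoisson_le {d : ℝ} (h0 : 0 < d) (h1 : d ≤ 1) (x : AddCircle (2 * π)) :
    d ^ 2 * ‖∑' k : ℤ, (k : ℂ) * ((((1 - d) ^ k.natAbs : ℝ) : ℂ) * fourier k x)‖ ≤
      24 * (2 * (|(fourier 1 x : ℂ).im| / d) / (1 + 2 * (|(fourier 1 x : ℂ).im| / d)) -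
        |(fourier 1 x : ℂ).im| / d / (1 + |(fourier 1 x : ℂ).im| / d)) := by
  have hr0 : 0 ≤ 1 - d := by linarith
  have hr1 : 1 - d < 1 := by linarith
  rw [(hasSum_conjPoisson hr0 hr1 x).tsum_eq]
  have hw : ‖(fourier 1 x : ℂ)‖ = 1 := by rw [fourier_apply, Circle.norm_coe]
  set w : ℂ := fourier 1 x with hwdef
  set s := |w.im| with hs
  have hs0 : 0 ≤ s := abs_nonneg _
  have hwsq : w.re ^ 2 + w.im ^ 2 = 1 := by
    have := Complex.sq_norm w
    rw [hw, Complex.normSq_apply] at this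
    linarith
  have hzn : ‖((1 - d : ℝ) : ℂ) * w‖ = 1 - d := by
    rw [norm_mul, hw, mul_one, Complex.norm_real, Real.norm_of_nonneg hr0]
  have hD : ‖1 - ((1 - d : ℝ) : ℂ) * w‖ ^ 2 = (1 - (1 - d) * w.re) ^ 2 + ((1 - d) * w.im) ^ 2 := by
    rw [Complex.sq_norm, Complex.normSq_apply]
    simp
    ring
  have hwre : w.re ≤ 1 := by nlinarith [sq_nonneg w.im]
  have hDd : d ^ 2 ≤ ‖1 - ((1 - d : ℝ) : ℂ) * w‖ ^ 2 := by
    rw [hD]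
    nlinarith [mul_nonneg hr0 (sub_nonneg.mpr hwre), sq_nonneg ((1 - d) * w.im)]
  have hDs : s ^ 2 ≤ ‖1 - ((1 - d : ℝ) : ℂ) * w‖ ^ 2 := by
    rw [hD, hs, sq_abs]
    have : (1 - (1 - d) * w.re) ^ 2 + ((1 - d) * w.im) ^ 2 - w.im ^ 2 =
      (1 - d - w.re) ^ 2 := by
      linear_combination ((1 - d) ^ 2 - 1) * hwsq
    nlinarith [sq_nonneg (1 - d - w.re)]
  have hne : 1 - ((1 - d : ℝ) : ℂ) * w ≠ 0 := by
    intro h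
    rw [h] at hDd
    simp at hDd
    nlinarith
  rw [conjPoisson_closed_form hne, hzn]
  set D := ‖1 - ((1 - d : ℝ) : ℂ) * w‖ ^ 2 with hDdef
  have hD0 : 0 < D := lt_of_lt_of_le (by positivity) hDd
  have him : (((1 - d : ℝ) : ℂ) * w).im = (1 - d) * w.im := by simp
  rw [norm_mul, Complex.norm_I, mul_one, Complex.norm_real, Real.norm_eq_abs, him, abs_div,
    abs_mul, abs_mul, abs_mul, ← hs, abs_of_nonneg hr0, abs_of_pos (by positivity : 0 < D ^ 2),
    abs_of_nonneg (by nlinarith : 0 ≤ 1 - (1 - d) ^ 2), abs_two]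
  have key := sub_div_one_add_le (u := s / d) (v := d ^ 3 * s / D ^ 2) (by positivity)
    (by
      rw [div_le_div_iff₀ (by positivity) h0]
      have : (d ^ 2) ^ 2 ≤ D ^ 2 := by gcongr
      nlinarith [mul_le_mul_of_nonneg_left this hs0])
    (by
      rw [div_mul_div_comm, div_le_one (by positivity)]
      have : d ^ 2 * s ^ 2 ≤ D * D := by gcongr
      nlinarith [mul_le_mul_of_nonneg_left this h0.le])
  refine le_trans ?_ ((mul_le_mul_of_nonneg_left key (by norm_num : (0 : ℝ) ≤ 4)).trans_eq (by ring))
  rw [mul_div_assoc', mul_div_assoc']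
  refine div_le_div_of_nonneg_right ?_ (by positivity)
  have : (1 - d) * (1 - (1 - d) ^ 2) ≤ 2 * d := by nlinarith [mul_nonneg h0.le hr0]
  have hh : 0 ≤ d ^ 2 * s := by positivity
  nlinarith [mul_le_mul_of_nonneg_left this hh]

/-! ### The dyadic weight and the boundedness of its kernel -/

variable {n : ℕ}

/-- The dyadic scales `2⁻¹, 2⁻², …`. -/
def dyadic (l : ℕ) : ℝ := (1 / 2) ^ (l + 1)

theorem dyadic_pos (l : ℕ) : 0 < dyadic l := by unfold dyadic; positivity

theorem dyadic_le_one (l : ℕ) : dyadic l ≤ 1 := pow_le_one₀ (by norm_num) (by norm_num)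

theorem dyadic_succ (l : ℕ) : 2 * dyadic (l + 1) = dyadic l := by
  unfold dyadic; rw [pow_succ _ (l + 1)]; ring

/-- A multiplier comparable to `|m|⁻⁽ⁿ⁺¹⁾` for `1 ≤ |m| ≲ 2ᴸ`, built from Poisson kernels at
dyadic scales. -/
def dyadicWeight (L : ℕ) (m : Fin n → ℤ) : ℝ :=
  ∑ l ∈ Finset.range L, dyadic l ^ (n + 1) * ∏ i, (1 - dyadic l) ^ (m i).natAbs

theorem dyadicWeight_term_nonneg (l : ℕ) (m : Fin n → ℤ) :
    0 ≤ dyadic l ^ (n + 1) * ∏ i, (1 - dyadic l) ^ (m i).natAbs :=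
  mul_nonneg (pow_nonneg (dyadic_pos l).le _)
    (Finset.prod_nonneg fun _ _ => pow_nonneg (sub_nonneg.mpr (dyadic_le_one l)) _)

theorem dyadicWeight_nonneg (L : ℕ) (m : Fin n → ℤ) : 0 ≤ dyadicWeight L m :=
  Finset.sum_nonneg fun l _ => dyadicWeight_term_nonneg l m

theorem norm_character (m : Fin n → ℤ) (x : Torus n) : ‖character m x‖ = 1 := by
  simp only [character, ContinuousMap.coe_mk, fourier_apply, norm_prod, Circle.norm_coe,
    Finset.prod_const_one]

/-- The series factors over coordinates. Coordinate `j` carries the differentiated Poisson kernel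
and uses `d²`; each of the other `n - 1` is at most `2/d` and uses one further power of `d`. -/
theorem poissonProduct_bound (j : Fin n) {d : ℝ} (h0 : 0 < d) (h1 : d ≤ 1) (x : Torus n) :
    (Summable fun m : Fin n → ℤ =>
      ‖(m j : ℂ) * ((∏ i, (1 - d) ^ (m i).natAbs : ℝ) : ℂ) * character m x‖) ∧
    d ^ (n + 1) * ‖∑' m : Fin n → ℤ,
        (m j : ℂ) * ((∏ i, (1 - d) ^ (m i).natAbs : ℝ) : ℂ) * character m x‖ ≤
      2 ^ (n - 1) * (24 * (2 * (|(fourier 1 (x j) : ℂ).im| / d) /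
          (1 + 2 * (|(fourier 1 (x j) : ℂ).im| / d)) -
        |(fourier 1 (x j) : ℂ).im| / d / (1 + |(fourier 1 (x j) : ℂ).im| / d))) := by
  have hr0 : 0 ≤ 1 - d := by linarith
  have hr1 : 1 - d < 1 := by linarith
  let f : Fin n → ℤ → ℂ := fun i k =>
    (if i = j then (k : ℂ) else 1) * ((((1 - d) ^ k.natAbs : ℝ) : ℂ) * fourier k (x i))
  have hf : ∀ i, Summable fun k => ‖f i k‖ := by
    intro i
    by_cases hi : i = j
    · simpa [f, hi] using summable_norm_conjPoisson hr0 hr1 (x j)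
    · simpa [f, hi] using summable_norm_poisson hr0 hr1 (x i)
  have hprod : ∀ m : Fin n → ℤ, ∏ i, f i (m i) =
      (m j : ℂ) * ((∏ i, (1 - d) ^ (m i).natAbs : ℝ) : ℂ) * character m x := by
    intro m
    simp only [f, Finset.prod_mul_distrib, Finset.prod_ite_eq', Finset.mem_univ, if_true]
    rw [Complex.ofReal_prod, mul_assoc]
    rfl
  obtain ⟨hs, ht⟩ := hasSum_pi_prod n f hf
  simp only [hprod] at hs ht
  refine ⟨hs, ?_⟩
  rw [ht.tsum_eq, ← Finset.mul_prod_erase _ _ (Finset.mem_univ j), norm_mul, norm_prod]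
  have hj := norm_tsum_conjPoisson_le h0 h1 (x j)
  have hfj : ∀ k : ℤ, (k : ℂ) * ((((1 - d) ^ k.natAbs : ℝ) : ℂ) * fourier k (x j)) = f j k :=
    fun k => by simp only [f, if_true]
  simp only [hfj] at hj
  have hi : ∏ i ∈ Finset.univ.erase j, ‖∑' k, f i k‖ ≤ (2 / d) ^ (n - 1) := by
    have hcard : (Finset.univ.erase j).card = n - 1 := by
      rw [Finset.card_erase_of_mem (Finset.mem_univ j), Finset.card_univ, Fintype.card_fin]
    rw [← hcard, ← Finset.prod_const]
    refine Finset.prod_le_prod (fun _ _ => norm_nonneg _) fun i hi => ?_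
    have hij : i ≠ j := Finset.ne_of_mem_erase hi
    have := norm_tsum_poisson_le hr0 hr1 (x i)
    rw [sub_sub_cancel] at this
    simpa only [f, if_neg hij, one_mul] using this
  have hd : d ^ (n + 1) = d ^ 2 * d ^ (n - 1) := by
    have := j.pos
    rw [← pow_add]
    congr 1
    omega
  calc d ^ (n + 1) * (‖∑' k, f j k‖ * ∏ i ∈ Finset.univ.erase j, ‖∑' k, f i k‖)
      ≤ d ^ (n + 1) * (‖∑' k, f j k‖ * (2 / d) ^ (n - 1)) := by gcongr
    _ = 2 ^ (n - 1) * (d ^ 2 * ‖∑' k, f j k‖) := by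
      rw [hd, div_pow]
      have : d ^ (n - 1) ≠ 0 := by positivity
      field_simp
    _ ≤ _ := by gcongr

theorem ofReal_dyadicWeight (L : ℕ) (m : Fin n → ℤ) (a b : ℂ) :
    a * (dyadicWeight L m : ℂ) * b = ∑ l ∈ Finset.range L, ((dyadic l ^ (n + 1) : ℝ) : ℂ) *
      (a * ((∏ i, (1 - dyadic l) ^ (m i).natAbs : ℝ) : ℂ) * b) := by
  rw [dyadicWeight, Complex.ofReal_sum, Finset.mul_sum, Finset.sum_mul]
  refine Finset.sum_congr rfl fun l _ => ?_
  push_cast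
  ring

theorem summable_norm_kernel (j : Fin n) (L : ℕ) :
    Summable fun m : Fin n → ℤ => ‖(m j : ℂ) * (dyadicWeight L m : ℂ)‖ := by
  have h : Summable fun m : Fin n → ℤ =>
      ∑ l ∈ Finset.range L, ‖((dyadic l ^ (n + 1) : ℝ) : ℂ)‖ *
        ‖(m j : ℂ) * ((∏ i, (1 - dyadic l) ^ (m i).natAbs : ℝ) : ℂ) * character m 0‖ :=
    summable_sum fun l _ =>
      ((poissonProduct_bound j (dyadic_pos l) (dyadic_le_one l) 0).1.mul_left _)
  refine Summable.of_nonneg_of_le (fun _ => norm_nonneg _) (fun m => ?_) h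
  have h1 : ‖(m j : ℂ) * (dyadicWeight L m : ℂ)‖ =
      ‖(m j : ℂ) * (dyadicWeight L m : ℂ) * character m 0‖ := by
    rw [norm_mul _ (character m 0), norm_character, mul_one]
  rw [h1, ofReal_dyadicWeight]
  refine (norm_sum_le _ _).trans_eq ?_
  simp_rw [norm_mul _ (_ * _ * _)]

/-- Passing from scale `l` to `l + 1` doubles `|sin xⱼ| / d`, so the bounds for the individual
scales telescope and the total does not depend on `L`. -/
theorem norm_tsum_kernel_le (j : Fin n) (L : ℕ) (x : Torus n) :
    ‖∑' m : Fin n → ℤ, (m j : ℂ) * (dyadicWeight L m : ℂ) * character m x‖ ≤ 24 * 2 ^ n := by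
  simp only [ofReal_dyadicWeight]
  set s := |(fourier 1 (x j) : ℂ).im| with hs
  have hs0 : 0 ≤ s := abs_nonneg _
  rw [Summable.tsum_finsetSum fun l _ =>
    ((poissonProduct_bound j (dyadic_pos l) (dyadic_le_one l) x).1.of_norm.mul_left _)]
  have hterm : ∀ l, ‖∑' m : Fin n → ℤ, ((dyadic l ^ (n + 1) : ℝ) : ℂ) *
      ((m j : ℂ) * ((∏ i, (1 - dyadic l) ^ (m i).natAbs : ℝ) : ℂ) * character m x)‖ ≤
      2 ^ (n - 1) * 24 * (s / dyadic (l + 1) / (1 + s / dyadic (l + 1)) -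
        s / dyadic l / (1 + s / dyadic l)) := by
    intro l
    rw [tsum_mul_left, norm_mul, Complex.norm_real,
      Real.norm_of_nonneg (pow_nonneg (dyadic_pos l).le _)]
    refine (poissonProduct_bound j (dyadic_pos l) (dyadic_le_one l) x).2.trans_eq ?_
    have : 2 * (s / dyadic l) = s / dyadic (l + 1) := by
      rw [← dyadic_succ l]
      have := (dyadic_pos (l + 1)).ne'
      field_simp
    rw [← hs, this, mul_assoc]
  refine (norm_sum_le _ _).trans ((Finset.sum_le_sum fun l _ => hterm l).trans ?_)
  rw [← Finset.mul_sum, Finset.sum_range_sub fun l => s / dyadic l / (1 + s / dyadic l)]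
  have hp : ∀ l, 0 ≤ s / dyadic l := fun l => div_nonneg hs0 (dyadic_pos l).le
  have h1 : s / dyadic L / (1 + s / dyadic L) ≤ 1 :=
    div_le_one_of_le₀ (by linarith [hp L]) (by linarith [hp L])
  have h2 : 0 ≤ s / dyadic 0 / (1 + s / dyadic 0) := div_nonneg (hp 0) (by linarith [hp 0])
  have h3 : (2 : ℝ) ^ (n - 1) ≤ 2 ^ n := pow_le_pow_right₀ (by norm_num) (Nat.sub_le _ _)
  calc 2 ^ (n - 1) * 24 * (s / dyadic L / (1 + s / dyadic L) - s / dyadic 0 / (1 + s / dyadic 0))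
      ≤ 2 ^ (n - 1) * 24 * 1 := by gcongr; linarith
    _ ≤ 24 * 2 ^ n := by linarith

/-! ### Comparability of the dyadic weight with `|m|^{-(n+1)}` -/

theorem abs_le_freqNorm (m : Fin n → ℤ) (i : Fin n) : |(m i : ℝ)| ≤ freqNorm m :=
  Real.abs_le_sqrt (Finset.single_le_sum (f := fun i => (m i : ℝ) ^ 2) (fun _ _ => sq_nonneg _)
    (Finset.mem_univ i))

theorem freqNorm_sq (m : Fin n → ℤ) : freqNorm m ^ 2 = ∑ i, (m i : ℝ) ^ 2 :=
  Real.sq_sqrt (Finset.sum_nonneg fun _ _ => sq_nonneg _)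

theorem freqNorm_le_sum (m : Fin n → ℤ) : freqNorm m ≤ ((∑ i, (m i).natAbs : ℕ) : ℝ) := by
  refine Real.sqrt_le_iff.mpr ⟨by positivity, ?_⟩
  push_cast
  simp only [Nat.cast_natAbs, Int.cast_abs]
  calc ∑ i, (m i : ℝ) ^ 2 = ∑ i, |(m i : ℝ)| ^ 2 := by simp
    _ ≤ _ := Finset.sum_sq_le_sq_sum_of_nonneg fun _ _ => abs_nonneg _

theorem freqNorm_pos {m : Fin n → ℤ} (hm : m ≠ 0) : 0 < freqNorm m := by
  obtain ⟨i, hi⟩ := Function.ne_iff.mp hm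
  refine lt_of_lt_of_le ?_ (abs_le_freqNorm m i)
  exact abs_pos.mpr (by exact_mod_cast hi)

theorem freqNorm_zero : freqNorm (0 : Fin n → ℤ) = 0 := by simp [freqNorm]

/-- With `u = |m| d`, each scale contributes at most `u^{n+1} e^{-u}`, because `1 - d ≤ e^{-d}` and
the `ℓ¹` length dominates `|m|`. After division by `(n+2)!` this is below `min(u, 1/u)`, so the sum
telescopes. -/
theorem freqNorm_pow_mul_dyadicWeight_le (L : ℕ) (m : Fin n → ℤ) :
    freqNorm m ^ (n + 1) * dyadicWeight L m ≤ 6 * (n + 2).factorial := by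
  have hN := freqNorm_nonneg m
  set N := freqNorm m with hNdef
  set q : ℝ := ((n + 2).factorial : ℝ) with hq
  have hq0 : 0 < q := by positivity
  have hterm : ∀ l, N ^ (n + 1) * (dyadic l ^ (n + 1) * ∏ i, (1 - dyadic l) ^ (m i).natAbs) ≤
      q * (6 * (2 * (N * dyadic l) / (1 + 2 * (N * dyadic l)) -
        N * dyadic l / (1 + N * dyadic l))) := by
    intro l
    have hd := dyadic_pos l
    set u := N * dyadic l with hu
    have hu0 : 0 ≤ u := by positivity
    have hexp : ∏ i, (1 - dyadic l) ^ (m i).natAbs ≤ Real.exp (-u) := by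
      rw [Finset.prod_pow_eq_pow_sum]
      calc (1 - dyadic l) ^ (∑ i, (m i).natAbs)
          ≤ Real.exp (-dyadic l) ^ (∑ i, (m i).natAbs) := by
            refine pow_le_pow_left₀ (sub_nonneg.mpr (dyadic_le_one l)) ?_ _
            linarith [Real.add_one_le_exp (-dyadic l)]
        _ = Real.exp (-(((∑ i, (m i).natAbs : ℕ) : ℝ) * dyadic l)) := by
            rw [← Real.exp_nat_mul, mul_neg]
        _ ≤ Real.exp (-u) := by
            rw [hu]
            gcongr
            exact freqNorm_le_sum m
    have hpow : ∀ k ≤ n + 2, u ^ k * Real.exp (-u) ≤ q := by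
      intro k hk
      have h1 := Real.pow_div_factorial_le_exp u hu0 k
      rw [div_le_iff₀ (by positivity)] at h1
      have h2 : (k.factorial : ℝ) ≤ q := Nat.cast_le.mpr (Nat.factorial_le hk)
      have h3 : Real.exp u * Real.exp (-u) = 1 := by rw [← Real.exp_add]; simp
      calc u ^ k * Real.exp (-u) ≤ (Real.exp u * k.factorial) * Real.exp (-u) := by gcongr
        _ = k.factorial := by rw [mul_right_comm, h3, one_mul]
        _ ≤ q := h2
    have key := sub_div_one_add_le (u := u) (v := u ^ (n + 1) * Real.exp (-u) / q) (by positivity)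
      (by
        rw [div_le_iff₀ hq0, pow_succ']
        have := mul_le_mul_of_nonneg_left (hpow n (by omega)) hu0
        linarith)
      (by
        rw [mul_div_assoc', div_le_one hq0]
        have := hpow (n + 2) le_rfl
        rw [pow_succ'] at this
        linarith)
    rw [div_le_iff₀' hq0] at key
    refine le_trans ?_ key
    rw [← mul_assoc, ← mul_pow]
    gcongr
  rw [dyadicWeight, Finset.mul_sum]
  refine (Finset.sum_le_sum fun l _ => hterm l).trans ?_
  have hsum : ∀ L : ℕ, ∑ l ∈ Finset.range L, (2 * (N * dyadic l) / (1 + 2 * (N * dyadic l)) -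
      N * dyadic l / (1 + N * dyadic l)) = N / (1 + N) -
        2 * (N * dyadic L) / (1 + 2 * (N * dyadic L)) := by
    intro L
    induction L with
    | zero =>
      have : 2 * (N * dyadic 0) = N := by unfold dyadic; ring
      simp [this]
    | succ L ih =>
      have : 2 * (N * dyadic (L + 1)) = N * dyadic L := by rw [← dyadic_succ L]; ring
      rw [Finset.sum_range_succ, ih, this]
      ring
  rw [← Finset.mul_sum, ← Finset.mul_sum, hsum]
  have h1 : N / (1 + N) ≤ 1 := div_le_one_of_le₀ (by linarith) (by linarith)
  have h2 : 0 ≤ 2 * (N * dyadic L) / (1 + 2 * (N * dyadic L)) := by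
    have := dyadic_pos L
    positivity
  nlinarith

/-- One scale suffices: `d = 2^{-(k+2)}`, where `2^k ≤ A < 2^{k+1}` and `A` is the `ℓ¹` length of
`m`. Bernoulli's inequality keeps the product above `1/2`, and `A ≤ n|m|` gives `|m| d ≥ 1/(4n)`. -/
theorem exists_le_freqNorm_pow_mul_dyadicWeight {m : Fin n → ℤ} (hm : m ≠ 0) :
    ∃ L₀, ∀ L ≥ L₀, (1 / (4 * n : ℝ)) ^ (n + 1) / 2 ≤ freqNorm m ^ (n + 1) * dyadicWeight L m := by
  set A : ℕ := ∑ i, (m i).natAbs with hA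
  obtain ⟨i₀, hi₀⟩ := Function.ne_iff.mp hm
  have hn : 0 < n := i₀.pos
  have hA0 : A ≠ 0 := by
    have := Finset.single_le_sum (f := fun i => (m i).natAbs) (fun _ _ => Nat.zero_le _)
      (Finset.mem_univ i₀)
    have h2 : (m i₀).natAbs ≠ 0 := Int.natAbs_ne_zero.mpr hi₀
    simp only [← hA] at this
    omega
  have hAN : (A : ℝ) ≤ n * freqNorm m := by
    rw [hA]
    push_cast
    simp only [Nat.cast_natAbs, Int.cast_abs]
    refine (Finset.sum_le_card_nsmul _ _ _ fun i _ => abs_le_freqNorm m i).trans_eq ?_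
    simp
  set k := Nat.log 2 A with hk
  have hk1 : (2 : ℝ) ^ k ≤ A := by exact_mod_cast Nat.pow_log_le_self 2 hA0
  have hk2 : (A : ℝ) < 2 ^ (k + 1) := by exact_mod_cast Nat.lt_pow_succ_log_self (by norm_num) A
  refine ⟨k + 2, fun L hL => ?_⟩
  have hle : dyadic (k + 1) ^ (n + 1) * ∏ i, (1 - dyadic (k + 1)) ^ (m i).natAbs ≤
      dyadicWeight L m :=
    Finset.single_le_sum (f := fun l => dyadic l ^ (n + 1) * ∏ i, (1 - dyadic l) ^ (m i).natAbs)
      (fun l _ => dyadicWeight_term_nonneg l m) (Finset.mem_range.mpr (by omega))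
  have hdval : dyadic (k + 1) * 2 ^ (k + 2) = 1 := by
    unfold dyadic
    rw [← mul_pow]; norm_num
  have hd := dyadic_pos (k + 1)
  set d := dyadic (k + 1) with hddef
  have hprod : 1 / 2 ≤ ∏ i, (1 - d) ^ (m i).natAbs := by
    rw [Finset.prod_pow_eq_pow_sum, ← hA]
    have := one_add_mul_le_pow (a := -d) (by linarith [dyadic_le_one (k + 1)]) A
    rw [← sub_eq_add_neg] at this
    refine le_trans ?_ this
    have h4 : (A : ℝ) * d ≤ 1 / 2 := by
      have : (2 : ℝ) ^ (k + 2) = 2 * 2 ^ (k + 1) := by ring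
      rw [this] at hdval
      nlinarith
    linarith
  have hdN : 1 / (4 * n : ℝ) ≤ freqNorm m * d := by
    have hn' : (0 : ℝ) < n := by exact_mod_cast hn
    rw [div_le_iff₀ (by positivity)]
    have : (2 : ℝ) ^ (k + 2) = 4 * 2 ^ k := by ring
    rw [this] at hdval
    nlinarith
  have hN0 := freqNorm_nonneg m
  calc (1 / (4 * n : ℝ)) ^ (n + 1) / 2 = (1 / (4 * n : ℝ)) ^ (n + 1) * (1 / 2) := by ring
    _ ≤ (freqNorm m * d) ^ (n + 1) * ∏ i, (1 - d) ^ (m i).natAbs := by gcongr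
    _ = freqNorm m ^ (n + 1) * (d ^ (n + 1) * ∏ i, (1 - d) ^ (m i).natAbs) := by
      rw [mul_pow]; ring
    _ ≤ _ := by gcongr

/-! ### Convolution forms on the dual of `C(Tⁿ)` -/

theorem norm_character_le (m : Fin n → ℤ) : ‖character m‖ ≤ 1 :=
  (ContinuousMap.norm_le _ zero_le_one).mpr fun x => (norm_character m x).le

theorem character_sub (m : Fin n → ℤ) (x y : Torus n) :
    character m (x - y) = character m x * conj (character m y) := by
  simp only [character, ContinuousMap.coe_mk, map_prod, ← Finset.prod_mul_distrib, Pi.sub_apply]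
  refine Finset.prod_congr rfl fun i _ => ?_
  rw [← fourier_neg, fourier_apply, fourier_apply, fourier_apply, smul_sub, sub_eq_add_neg,
    AddCircle.toCircle_add, neg_smul, Circle.coe_mul]

theorem summable_smul_character {k : (Fin n → ℤ) → ℂ} (hk : Summable fun m => ‖k m‖) :
    Summable fun m => k m • character m :=
  .of_norm_bounded hk fun m => by
    rw [norm_smul]
    exact mul_le_of_le_one_right (norm_nonneg _) (norm_character_le m)

theorem norm_apply_character_le (μ : C(Torus n, ℂ) →L[ℂ] ℂ) (m : Fin n → ℤ) :
    ‖μ (character m)‖ ≤ ‖μ‖ :=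
  (μ.le_opNorm _).trans (mul_le_of_le_one_right (norm_nonneg _) (norm_character_le m))

theorem summable_norm_bilinear {k : (Fin n → ℤ) → ℂ} (hk : Summable fun m => ‖k m‖)
    (μ ν : C(Torus n, ℂ) →L[ℂ] ℂ) :
    Summable fun m => ‖k m * μ (character m) * conj (ν (character m))‖ := by
  refine .of_nonneg_of_le (fun _ => norm_nonneg _) (fun m => ?_) (hk.mul_right (‖μ‖ * ‖ν‖))
  rw [norm_mul, norm_mul, RCLike.norm_conj, mul_assoc]
  gcongr
  · exact norm_apply_character_le μ m
  · exact norm_apply_character_le ν m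

/-- The bilinear form with convolution kernel `∑ k(m) χₘ` is bounded on the dual of `C(Tⁿ)` by the
supremum of the kernel. -/
theorem norm_bilinear_le {k : (Fin n → ℤ) → ℂ} (hk : Summable fun m => ‖k m‖) {B : ℝ}
    (hB : ∀ x, ‖∑' m, k m * character m x‖ ≤ B) (μ ν : C(Torus n, ℂ) →L[ℂ] ℂ) :
    ‖∑' m, k m * μ (character m) * conj (ν (character m))‖ ≤ B * ‖μ‖ * ‖ν‖ := by
  have hB0 : 0 ≤ B := (norm_nonneg _).trans (hB 0)
  have hkμ : Summable fun m => ‖conj (k m * μ (character m))‖ := by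
    refine .of_nonneg_of_le (fun _ => norm_nonneg _) (fun m => ?_) (hk.mul_right ‖μ‖)
    rw [RCLike.norm_conj, norm_mul]
    gcongr
    exact norm_apply_character_le μ m
  have eval : ∀ {c : (Fin n → ℤ) → ℂ}, Summable (fun m => ‖c m‖) → ∀ x,
      (∑' m, c m • character m) x = ∑' m, c m * character m x := by
    intro c hc x
    have := ((summable_smul_character hc).hasSum.mapL (ContinuousMap.evalCLM ℂ x)).tsum_eq
    simpa using this.symm
  have hh : ‖∑' m, conj (k m * μ (character m)) • character m‖ ≤ B * ‖μ‖ := by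
    refine (ContinuousMap.norm_le _ (by positivity)).mpr fun y => ?_
    have hky : Summable fun m => ‖k m * conj (character m y)‖ := by
      simpa [norm_character] using hk
    -- This function of `x` is the kernel translated to `x - y`. Applying `μ` in `x` and then `ν` in
    -- `y` replaces integration against measures.
    have hG : ‖∑' m, (k m * conj (character m y)) • character m‖ ≤ B := by
      refine (ContinuousMap.norm_le _ hB0).mpr fun x => ?_
      rw [eval hky]
      refine le_of_eq_of_le ?_ (hB (x - y))
      congr 1
      refine tsum_congr fun m => ?_
      rw [character_sub]
      ring
    have h1 := ((summable_smul_character hky).hasSum.mapL μ).tsum_eq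
    rw [eval hkμ, ← RCLike.norm_conj, Complex.conj_tsum]
    calc ‖∑' m, conj (conj (k m * μ (character m)) * character m y)‖
        = ‖μ (∑' m, (k m * conj (character m y)) • character m)‖ := by
          rw [← h1]
          congr 1
          refine tsum_congr fun m => ?_
          rw [map_mul, Complex.conj_conj, map_smul, smul_eq_mul]
          ring
      _ ≤ ‖μ‖ * B := (μ.le_opNorm _).trans (by gcongr)
      _ = B * ‖μ‖ := mul_comm _ _
  have h2 := ((summable_smul_character hkμ).hasSum.mapL ν).tsum_eq
  rw [← RCLike.norm_conj, Complex.conj_tsum]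
  calc ‖∑' m, conj (k m * μ (character m) * conj (ν (character m)))‖
      = ‖ν (∑' m, conj (k m * μ (character m)) • character m)‖ := by
        rw [← h2]
        congr 1
        refine tsum_congr fun m => ?_
        rw [map_mul, Complex.conj_conj, map_smul, smul_eq_mul]
    _ ≤ ‖ν‖ * (B * ‖μ‖) := (ν.le_opNorm _).trans (by gcongr)
    _ = B * ‖μ‖ * ‖ν‖ := by ring

/-! ### The quadratic estimate on the dual side -/

/-- As `r` is a unit vector, the sum collapses to `(p - a₀)(conj p - e)` with `e = ∑ rⱼ conj aⱼ`;
the cross terms are absorbed into half of `‖p‖²`, and `‖e‖² ≤ ∑ ‖aⱼ‖²` by Cauchy–Schwarz. -/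
theorem norm_sq_le_re_add (p a₀ : ℂ) (r a : Fin n → ℂ) (hr : ∑ j, ‖r j‖ ^ 2 = 1) :
    ‖p‖ ^ 2 ≤ 2 * (∑ j, r j * (p - a₀) * conj (p * r j - a j)).re +
      3 * (‖a₀‖ ^ 2 + ∑ j, ‖a j‖ ^ 2) := by
  set e := ∑ j, r j * conj (a j) with he
  have hsum : ∑ j, r j * (p - a₀) * conj (p * r j - a j) = (p - a₀) * (conj p - e) := by
    have h1 : ∑ j, r j * conj (r j) = 1 := by
      simp_rw [Complex.mul_conj, Complex.normSq_eq_norm_sq]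
      exact_mod_cast hr
    calc ∑ j, r j * (p - a₀) * conj (p * r j - a j)
        = (p - a₀) * (conj p * ∑ j, r j * conj (r j) - e) := by
          rw [he, Finset.mul_sum, ← Finset.sum_sub_distrib, Finset.mul_sum]
          refine Finset.sum_congr rfl fun j _ => ?_
          rw [map_sub, map_mul]
          ring
      _ = _ := by rw [h1, mul_one]
  have hen : ‖e‖ ^ 2 ≤ ∑ j, ‖a j‖ ^ 2 := by
    have h1 : ‖e‖ ≤ ∑ j, ‖r j‖ * ‖a j‖ := (norm_sum_le _ _).trans_eq (by simp)
    calc ‖e‖ ^ 2 ≤ (∑ j, ‖r j‖ * ‖a j‖) ^ 2 := by gcongr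
      _ ≤ (∑ j, ‖r j‖ ^ 2) * ∑ j, ‖a j‖ ^ 2 := Finset.sum_mul_sq_le_sq_mul_sq _ _ _
      _ = _ := by rw [hr, one_mul]
  have hp : ‖p‖ ^ 2 = ((p - a₀) * (conj p - e)).re + (p * e).re + (a₀ * conj p).re
      - (a₀ * e).re := by
    have h0 : (p * conj p).re = ‖p‖ ^ 2 := by
      rw [Complex.mul_conj, Complex.normSq_eq_norm_sq, Complex.ofReal_re]
    rw [← h0, ← Complex.add_re, ← Complex.add_re, ← Complex.sub_re]
    congr 1
    ring
  have h1 : (p * e).re ≤ ‖p‖ * ‖e‖ := (Complex.re_le_norm _).trans_eq (norm_mul _ _)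
  have h2 : (a₀ * conj p).re ≤ ‖a₀‖ * ‖p‖ := (Complex.re_le_norm _).trans_eq (by simp)
  have h3 : -(a₀ * e).re ≤ ‖a₀‖ * ‖e‖ := by
    rw [← Complex.neg_re]
    exact (Complex.re_le_norm _).trans_eq (by simp)
  rw [hsum]
  nlinarith [sq_nonneg (‖p‖ - ‖e‖ - ‖a₀‖), sq_nonneg (‖e‖ - ‖a₀‖)]

/-- The nonzero frequencies. -/
abbrev Freq (n : ℕ) : Type := {m : Fin n → ℤ // m ≠ 0}

/-- The symbols of the identity and of the conjugate Riesz transforms. -/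
def systemSymbol (i : Option (Fin n)) (m : Fin n → ℤ) : ℂ :=
  i.elim 1 fun j => conj (rieszSymbol j m)

theorem conj_rieszSymbol (j : Fin n) (m : Fin n → ℤ) :
    conj (rieszSymbol j m) = -Complex.I * (m j : ℂ) / (freqNorm m : ℂ) := by
  rw [rieszSymbol, map_mul, Complex.conj_I, Complex.conj_ofReal]
  push_cast
  ring

theorem sum_norm_sq_rieszSymbol {m : Fin n → ℤ} (hm : m ≠ 0) :
    ∑ j, ‖conj (rieszSymbol j m)‖ ^ 2 = 1 := by
  have hN := freqNorm_pos hm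
  have : ∀ j, ‖conj (rieszSymbol j m)‖ ^ 2 = (m j : ℝ) ^ 2 / freqNorm m ^ 2 := by
    intro j
    rw [RCLike.norm_conj, rieszSymbol, norm_mul, Complex.norm_I, one_mul, Complex.norm_real,
      Real.norm_eq_abs, sq_abs, div_pow]
  simp_rw [this]
  rw [← Finset.sum_div, ← freqNorm_sq, div_self (by positivity)]

/-- The constant in `sum_norm_sq_le_of_decomposition`. -/
def decompositionConst (n : ℕ) : ℝ :=
  (n * (2 * (24 * 2 ^ n)) + 3 * (6 * (n + 2).factorial) * (n + 1)) /
    ((1 / (4 * n : ℝ)) ^ (n + 1) / 2)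

theorem sum_norm_sq_le_of_decomposition {ε : ℝ} (hε : 0 ≤ ε) (p : Freq n → ℂ)
    (a : Option (Fin n) → Freq n → ℂ) (μ : Option (Fin n) → C(Torus n, ℂ) →L[ℂ] ℂ)
    (ha : ∀ i, Summable fun m => ‖a i m‖ ^ 2) (haε : ∀ i, ∑' m, ‖a i m‖ ^ 2 ≤ ε ^ 2)
    (hμ : ∀ i, ‖μ i‖ ≤ ε)
    (h : ∀ i (m : Freq n), p m * (systemSymbol i m * ((freqNorm m.1 ^ ((n : ℝ) / 2) : ℝ) : ℂ)) =
      ((freqNorm m.1 ^ ((n : ℝ) / 2) : ℝ) : ℂ) * a i m + μ i (character m))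
    (F : Finset (Freq n)) :
    ∑ m ∈ F, ‖p m‖ ^ 2 ≤ decompositionConst n * ε ^ 2 := by
  rcases F.eq_empty_or_nonempty with rfl | ⟨m₁, hm₁⟩
  · rw [Finset.sum_empty]
    unfold decompositionConst
    positivity
  have hn : 0 < n := by
    obtain ⟨i, -⟩ := Function.ne_iff.mp m₁.2
    exact i.pos
  have hn' : (0 : ℝ) < n := by exact_mod_cast hn
  set c : ℝ := (1 / (4 * n : ℝ)) ^ (n + 1) / 2 with hc
  have hc0 : 0 < c := by positivity
  choose L₀ hL₀ using fun m : Freq n => exists_le_freqNorm_pow_mul_dyadicWeight m.2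
  -- `L` is large enough for the lower bound on the weight at every frequency of `F`; the upper
  -- bounds used below do not involve `L`.
  set L := F.sup L₀ with hL
  let ρ : Freq n → ℝ := fun m => freqNorm m.1 ^ (n + 1) * dyadicWeight L m.1
  have hρ0 : ∀ m, 0 ≤ ρ m := fun m =>
    mul_nonneg (pow_nonneg (freqNorm_nonneg _) _) (dyadicWeight_nonneg _ _)
  have hρ1 : ∀ m, ρ m ≤ 6 * (n + 2).factorial := fun m => freqNorm_pow_mul_dyadicWeight_le L m.1
  let k : Fin n → (Fin n → ℤ) → ℂ := fun j m => -Complex.I * ((m j : ℂ) * (dyadicWeight L m : ℂ))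
  have hk : ∀ j, Summable fun m => ‖k j m‖ := fun j => by
    simpa [k] using summable_norm_kernel j L
  have hkB : ∀ j x, ‖∑' m, k j m * character m x‖ ≤ 24 * 2 ^ n := fun j x => by
    simp only [k, mul_assoc]
    rw [tsum_mul_left, norm_mul, norm_neg, Complex.norm_I, one_mul]
    simpa only [mul_assoc] using norm_tsum_kernel_le j L x
  let t : Fin n → (Fin n → ℤ) → ℂ := fun j m =>
    k j m * μ none (character m) * conj (μ (some j) (character m))
  have ht : ∀ j, Summable (t j) := fun j => (summable_norm_bilinear (hk j) _ _).of_norm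
  have htM : ∀ j, Summable fun m : Freq n => t j m := fun j =>
    (ht j).comp_injective Subtype.val_injective
  have htB : ∀ j, ‖∑' m : Freq n, t j m‖ ≤ 24 * 2 ^ n * ε ^ 2 := by
    intro j
    -- The zero frequency contributes nothing, since the kernel symbol contains the factor `mⱼ`.
    have h1 : ∑' m : Freq n, t j m = ∑' m, t j m := by
      refine Subtype.val_injective.tsum_eq (f := t j) fun m hm => ?_
      refine ⟨⟨m, ?_⟩, rfl⟩
      rintro rfl
      exact hm (by simp [t, k])
    rw [h1]
    refine (norm_bilinear_le (hk j) (hkB j) _ _).trans ?_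
    rw [mul_assoc, sq]
    gcongr
    · exact hμ _
    · exact hμ _
  let G : Freq n → ℝ := fun m =>
    2 * (∑ j, t j m).re + 3 * (6 * (n + 2).factorial) * ∑ i, ‖a i m‖ ^ 2
  have hG1 : Summable fun m : Freq n => 2 * (∑ j, t j m).re :=
    (Complex.reCLM.summable (summable_sum fun j _ => htM j)).mul_left 2
  have hG2 : Summable fun m : Freq n => 3 * (6 * ((n + 2).factorial : ℝ)) * ∑ i, ‖a i m‖ ^ 2 :=
    (summable_sum fun i _ => ha i).mul_left _
  have hG : Summable G := hG1.add hG2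
  have hpoint : ∀ m, ρ m * ‖p m‖ ^ 2 ≤ G m := by
    intro m
    have hN := freqNorm_pos m.2
    set N := freqNorm m.1 with hNdef
    set s : ℝ := N ^ ((n : ℝ) / 2) with hs
    have hs2 : s * s = N ^ n := by
      rw [hs, ← Real.rpow_add hN, add_halves, Real.rpow_natCast]
    have hμm : ∀ i, μ i (character m) = (s : ℂ) * (p m * systemSymbol i m - a i m) := by
      intro i
      linear_combination -(h i m)
    -- The two factors `|m|^{n/2}` from `μ₀` and `μⱼ` give `|m|^n`; the remaining power in `ρ`
    -- cancels the denominator of the Riesz symbol.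
    have hts : ∀ j, t j m = (ρ m : ℂ) * (conj (rieszSymbol j m.1) * (p m - a none m) *
        conj (p m * conj (rieszSymbol j m.1) - a (some j) m)) := by
      intro j
      have hNc : (N : ℂ) ≠ 0 := by exact_mod_cast hN.ne'
      have hs2c : (s : ℂ) * s = (N : ℂ) ^ n := by exact_mod_cast hs2
      simp only [t, k, hμm, ρ, systemSymbol, Option.elim, mul_one, map_mul, Complex.conj_ofReal]
      rw [conj_rieszSymbol, ← hNdef]
      push_cast
      generalize (starRingEnd ℂ) (p m * (-Complex.I * (m.1 j : ℂ) / (N : ℂ)) - a (some j) m) = z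
      rw [pow_succ]
      field_simp
      linear_combination (-(m.1 j : ℂ) * (dyadicWeight L m.1 : ℂ) * (p m - a none m) * z) * hs2c
    have h1 := norm_sq_le_re_add (p m) (a none m) (fun j => conj (rieszSymbol j m.1))
      (fun j => a (some j) m) (sum_norm_sq_rieszSymbol m.2)
    have h2 : (∑ j, t j m).re = ρ m * (∑ j, conj (rieszSymbol j m.1) * (p m - a none m) *
        conj (p m * conj (rieszSymbol j m.1) - a (some j) m)).re := by
      simp_rw [hts]
      rw [← Finset.mul_sum, Complex.re_ofReal_mul]
    have h3 : ∑ i, ‖a i m‖ ^ 2 = ‖a none m‖ ^ 2 + ∑ j, ‖a (some j) m‖ ^ 2 :=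
      Fintype.sum_option _
    have h4 : (0 : ℝ) ≤ ∑ i, ‖a i m‖ ^ 2 := Finset.sum_nonneg fun _ _ => sq_nonneg _
    simp only [G]
    rw [h2]
    rw [← h3] at h1
    have h5 := mul_le_mul_of_nonneg_left h1 (hρ0 m)
    have h6 := mul_le_mul_of_nonneg_right (hρ1 m) h4
    linarith
  have hGsum : ∑' m, G m ≤
      (n * (2 * (24 * 2 ^ n)) + 3 * (6 * (n + 2).factorial) * (n + 1)) * ε ^ 2 := by
    simp only [G]
    rw [hG1.tsum_add hG2, tsum_mul_left, tsum_mul_left, Summable.tsum_finsetSum fun i _ => ha i,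
      ← Complex.re_tsum (summable_sum fun j _ => htM j), Summable.tsum_finsetSum fun j _ => htM j]
    have h1 : (∑ j, ∑' m : Freq n, t j m).re ≤ n * (24 * 2 ^ n * ε ^ 2) := by
      refine (Complex.re_le_norm _).trans ((norm_sum_le _ _).trans ?_)
      refine (Finset.sum_le_card_nsmul _ _ _ fun j _ => htB j).trans_eq ?_
      simp
    have h2 : ∑ i, ∑' m, ‖a i m‖ ^ 2 ≤ (n + 1) * ε ^ 2 := by
      refine (Finset.sum_le_card_nsmul _ _ _ fun i _ => haε i).trans_eq ?_
      simp
    have h3 := mul_le_mul_of_nonneg_left h2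
      (by positivity : (0 : ℝ) ≤ 3 * (6 * (n + 2).factorial))
    linarith
  have hfin : c * ∑ m ∈ F, ‖p m‖ ^ 2 ≤ ∑' m, G m := by
    rw [Finset.mul_sum]
    refine (Finset.sum_le_sum fun m hm => ?_).trans
      (hG.sum_le_tsum F fun m _ => (mul_nonneg (hρ0 m) (sq_nonneg _)).trans (hpoint m))
    refine le_trans ?_ (hpoint m)
    gcongr
    exact hL₀ m L (Finset.le_sup hm)
  rw [decompositionConst, ← hc, div_mul_eq_mul_div, le_div_iff₀' hc0]
  exact hfin.trans hGsum

/-! ### The Banach spaces and the operator on the Fourier side -/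

/-- Square summable sequences on the nonzero frequencies. -/
abbrev FreqL2 (n : ℕ) : Type := lp (fun _ : Freq n => ℂ) 2

theorem FreqL2.summable_norm_sq (y : FreqL2 n) : Summable fun m => ‖y m‖ ^ 2 := by
  simpa using (lp.memℓp y).summable (by norm_num)

theorem FreqL2.norm_sq_eq (y : FreqL2 n) : ‖y‖ ^ 2 = ∑' m, ‖y m‖ ^ 2 := by
  simpa using lp.norm_rpow_eq_tsum (p := 2) (by norm_num) y

theorem memℓp_two_of_summable {y : Freq n → ℂ} (h : Summable fun m => ‖y m‖ ^ 2) : Memℓp y 2 :=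
  memℓp_gen (by simpa using h)

/-- Pointwise multiplication by a symbol of absolute value at most one. -/
def FreqL2.mulCLM (r : Freq n → ℂ) (hr : ∀ m, ‖r m‖ ≤ 1) : FreqL2 n →L[ℂ] FreqL2 n :=
  have hle : ∀ (y : FreqL2 n) m, ‖r m * y m‖ ^ 2 ≤ ‖y m‖ ^ 2 := fun y m => by
    rw [norm_mul]
    gcongr
    exact mul_le_of_le_one_left (norm_nonneg _) (hr m)
  have hs : ∀ y : FreqL2 n, Summable fun m => ‖r m * y m‖ ^ 2 := fun y =>
    .of_nonneg_of_le (fun _ => sq_nonneg _) (hle y) y.summable_norm_sq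
  LinearMap.mkContinuous
    { toFun := fun y => ⟨fun m => r m * y m, memℓp_two_of_summable (hs y)⟩
      map_add' := fun y z => by ext m; exact mul_add _ _ _
      map_smul' := fun c y => by ext m; exact mul_left_comm _ _ _ } 1 fun y => by
    rw [one_mul]
    refine (pow_le_pow_iff_left₀ (norm_nonneg _) (norm_nonneg _) two_ne_zero).mp ?_
    rw [FreqL2.norm_sq_eq, FreqL2.norm_sq_eq]
    exact (hs y).tsum_le_tsum (hle y) y.summable_norm_sq

theorem hasSum_norm_sq_dual (φ : FreqL2 n →L[ℂ] ℂ) :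
    HasSum (fun m => ‖φ (lp.single 2 m 1)‖ ^ 2) (‖φ‖ ^ 2) := by
  set y := (InnerProductSpace.toDual ℂ (FreqL2 n)).symm φ with hy
  have h1 : ∀ m, ‖φ (lp.single 2 m 1)‖ = ‖y m‖ := by
    intro m
    rw [← InnerProductSpace.toDual_symm_apply, ← hy, lp.inner_single_right]
    simp
  have h2 : ‖φ‖ = ‖y‖ := by rw [hy, LinearIsometryEquiv.norm_map]
  simp_rw [h1]
  rw [h2, FreqL2.norm_sq_eq]
  exact y.summable_norm_sq.hasSum

/-- The Fourier coefficient as a functional on `C(Tⁿ)`. -/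
def coeffCLM (m : Fin n → ℤ) : C(Torus n, ℂ) →L[ℂ] ℂ :=
  ((1 / (2 * π) ^ n : ℝ) : ℂ) • (innerSL ℂ (ofContinuous (character m))).comp
    (ContinuousMap.toLp (E := ℂ) 2 (volume : Measure (Torus n)) ℂ)

theorem coeffCLM_apply (m : Fin n → ℤ) (f : C(Torus n, ℂ)) :
    coeffCLM m f = coeff (ofContinuous f) m := by
  rw [coeff_eq_inner]; rfl

theorem coeff_character (m k : Fin n → ℤ) :
    coeff (ofContinuous (character m)) k = if k = m then 1 else 0 := by
  rw [coeff_eq_inner, inner_character]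
  split_ifs
  · have : ((2 * π : ℝ) : ℂ) ^ n ≠ 0 := pow_ne_zero _ (by exact_mod_cast Real.two_pi_pos.ne')
    push_cast at this ⊢
    field_simp
  · simp

/-- The space `Ḣ^{n/2}(Tⁿ) ∩ C⁰(Tⁿ)`, as pairs of a sequence `|m|^{n/2} f̂(m)` and a function. -/
def sobolevCont (n : ℕ) : Submodule ℂ (FreqL2 n × C(Torus n, ℂ)) where
  carrier := {q | ∀ m : Freq n,
    q.1 m = ((freqNorm m.1 ^ ((n : ℝ) / 2) : ℝ) : ℂ) * coeffCLM m.1 q.2}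
  add_mem' {q q'} hq hq' m := by
    simp only [Prod.fst_add, Prod.snd_add, map_add, lp.coeFn_add, Pi.add_apply, hq m, hq' m,
      mul_add]
  zero_mem' m := by simp
  smul_mem' c q hq m := by
    simp only [Prod.smul_fst, Prod.smul_snd, map_smul, lp.coeFn_smul, Pi.smul_apply, hq m,
      smul_eq_mul]
    ring

theorem isClosed_sobolevCont (n : ℕ) :
    IsClosed (sobolevCont n : Set (FreqL2 n × C(Torus n, ℂ))) := by
  have : (sobolevCont n : Set (FreqL2 n × C(Torus n, ℂ))) = ⋂ m : Freq n,
      {q | q.1 m = ((freqNorm m.1 ^ ((n : ℝ) / 2) : ℝ) : ℂ) * coeffCLM m.1 q.2} := by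
    ext q; simp [sobolevCont]
  rw [this]
  refine isClosed_iInter fun m => isClosed_eq ?_ ?_
  · exact (lp.lipschitzWith_one_eval 2 m).continuous.comp continuous_fst
  · exact continuous_const.mul ((coeffCLM m.1).continuous.comp continuous_snd)

instance : CompleteSpace (sobolevCont n) := (isClosed_sobolevCont n).completeSpace_coe

theorem norm_systemSymbol_le (i : Option (Fin n)) (m : Fin n → ℤ) : ‖systemSymbol i m‖ ≤ 1 := by
  cases i with
  | none => simp [systemSymbol]
  | some j =>
    rw [systemSymbol, Option.elim, RCLike.norm_conj]
    exact norm_rieszSymbol_le j m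

/-- The operator `(fᵢ) ↦ (-Δ)^{n/4} f₀ + ∑ⱼ (-Δ)^{n/4} 𝓡̄ⱼ fⱼ`, on the Fourier side. -/
def system (n : ℕ) : (Option (Fin n) → sobolevCont n) →L[ℂ] FreqL2 n :=
  ∑ i, (FreqL2.mulCLM (fun m => systemSymbol i m.1) fun m => norm_systemSymbol_le i m.1).comp
    ((ContinuousLinearMap.fst ℂ (FreqL2 n) C(Torus n, ℂ)).comp
      ((sobolevCont n).subtypeL.comp (ContinuousLinearMap.proj i)))

theorem system_apply (x : Option (Fin n) → sobolevCont n) (m : Freq n) :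
    system n x m = ∑ i, systemSymbol i m.1 * (x i).1.1 m := by
  have h : system n x = ∑ i, FreqL2.mulCLM (fun m => systemSymbol i m.1)
      (fun m => norm_systemSymbol_le i m.1) (x i).1.1 := by
    rw [system, sum_apply]
    rfl
  rw [h, lp.coeFn_sum, Finset.sum_apply]
  rfl

/-- The element of `Ḣ^{n/2}(Tⁿ) ∩ C⁰(Tⁿ)` given by a character. -/
def characterElement (m : Freq n) : sobolevCont n :=
  ⟨(((freqNorm m.1 ^ ((n : ℝ) / 2) : ℝ) : ℂ) • lp.single 2 m 1, character m.1), fun k => by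
    rw [coeffCLM_apply, coeff_character]
    simp only [lp.coeFn_smul, Pi.smul_apply, lp.single_apply, smul_eq_mul, Pi.single_apply,
      Subtype.ext_iff]
    split_ifs with h
    · rw [h]
    · simp⟩

theorem system_single_characterElement (i : Option (Fin n)) (m : Freq n) :
    system n (Pi.single i (characterElement m)) =
      (systemSymbol i m.1 * ((freqNorm m.1 ^ ((n : ℝ) / 2) : ℝ) : ℂ)) • lp.single 2 m 1 := by
  ext k
  rw [system_apply, Finset.sum_eq_single i]
  · rw [Pi.single_eq_same]
    simp only [characterElement, lp.coeFn_smul, Pi.smul_apply, lp.single_apply, smul_eq_mul,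
      Pi.single_apply]
    split_ifs with h
    · rw [h]; ring
    · simp
  · intro i' _ hi'
    rw [Pi.single_eq_of_ne hi']
    simp
  · simp

/-- Hahn–Banach splits each component of `φ ∘ system n` into an `ℓ²` part and a part on `C(Tⁿ)`;
evaluation at `characterElement m` yields the relations required by
`sum_norm_sq_le_of_decomposition`. -/
theorem norm_le_mul_norm_comp_system (φ : FreqL2 n →L[ℂ] ℂ) :
    ‖φ‖ ≤ √(decompositionConst n) * ‖φ.comp (system n)‖ := by
  set ε := ‖φ.comp (system n)‖ with hε
  have hε0 : 0 ≤ ε := norm_nonneg (φ.comp (system n))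
  let ψ : Option (Fin n) → sobolevCont n →L[ℂ] ℂ := fun i =>
    (φ.comp (system n)).comp (ContinuousLinearMap.single ℂ (fun _ => sobolevCont n) i)
  have hψ : ∀ i, ‖ψ i‖ ≤ ε := fun i => by
    refine ContinuousLinearMap.opNorm_le_bound _ hε0 fun x => ?_
    refine ((φ.comp (system n)).le_opNorm (Pi.single i x)).trans_eq ?_
    rw [Pi.norm_single]
  choose Λ hΛ hΛn using fun i => exists_extension_norm_eq (sobolevCont n) (ψ i)
  let α : Option (Fin n) → FreqL2 n →L[ℂ] ℂ := fun i =>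
    (Λ i).comp (ContinuousLinearMap.inl ℂ (FreqL2 n) C(Torus n, ℂ))
  let μ : Option (Fin n) → C(Torus n, ℂ) →L[ℂ] ℂ := fun i =>
    (Λ i).comp (ContinuousLinearMap.inr ℂ (FreqL2 n) C(Torus n, ℂ))
  have hα : ∀ i, ‖α i‖ ≤ ε := fun i => by
    refine ContinuousLinearMap.opNorm_le_bound _ hε0 fun x => ?_
    refine ((Λ i).le_opNorm (x, 0)).trans ?_
    rw [hΛn, Prod.norm_mk, norm_zero, max_eq_left (norm_nonneg _)]
    gcongr
    exact hψ i
  have hμ : ∀ i, ‖μ i‖ ≤ ε := fun i => by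
    refine ContinuousLinearMap.opNorm_le_bound _ hε0 fun x => ?_
    refine ((Λ i).le_opNorm (0, x)).trans ?_
    rw [hΛn, Prod.norm_mk, norm_zero, max_eq_right (norm_nonneg _)]
    gcongr
    exact hψ i
  have key := sum_norm_sq_le_of_decomposition hε0
    (fun m => φ (lp.single 2 m 1)) (fun i m => α i (lp.single 2 m 1)) μ
    (fun i => (hasSum_norm_sq_dual (α i)).summable)
    (fun i => by
      rw [(hasSum_norm_sq_dual (α i)).tsum_eq]
      gcongr
      exact hα i) hμ
    (fun i m => by
      have h1 := hΛ i (characterElement m)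
      have h2 : ψ i (characterElement m) = φ (system n (Pi.single i (characterElement m))) := rfl
      rw [h2, system_single_characterElement, map_smul, smul_eq_mul] at h1
      have h3 : Λ i (characterElement m : FreqL2 n × C(Torus n, ℂ)) =
          α i (((freqNorm m.1 ^ ((n : ℝ) / 2) : ℝ) : ℂ) • lp.single 2 m 1) +
            μ i (character m.1) := by
        simp only [α, μ, ContinuousLinearMap.comp_apply, ContinuousLinearMap.inl_apply,
          ContinuousLinearMap.inr_apply]
        rw [← map_add, Prod.mk_add_mk, add_zero, zero_add]
        rfl
      rw [h3, map_smul, smul_eq_mul] at h1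
      rw [h1]
      ring)
  have h1 : ‖φ‖ ^ 2 ≤ decompositionConst n * ε ^ 2 := by
    rw [← (hasSum_norm_sq_dual φ).tsum_eq]
    exact (hasSum_norm_sq_dual φ).summable.tsum_le_of_sum_le key
  have h2 := Real.sqrt_le_sqrt h1
  rwa [Real.sqrt_sq (norm_nonneg _), Real.sqrt_mul' _ (sq_nonneg _),
    Real.sqrt_sq hε0] at h2

/-! ### Stone–Weierstrass and completeness of the characters in `L²(Tⁿ)` -/

theorem character_add_eq_mul (m k : Fin n → ℤ) : character (m + k) = character m * character k := by
  ext x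
  simp only [character, ContinuousMap.coe_mk, ContinuousMap.mul_apply, Pi.add_apply, fourier_add,
    Finset.prod_mul_distrib]

theorem character_zero : character (0 : Fin n → ℤ) = 1 := by
  ext x
  simp [character]

theorem character_single (i : Fin n) (x : Torus n) :
    character (Pi.single i 1) x = fourier 1 (x i) := by
  simp only [character, ContinuousMap.coe_mk]
  rw [Finset.prod_eq_single i]
  · rw [Pi.single_eq_same]
  · intro k _ hk
    rw [Pi.single_eq_of_ne hk, fourier_zero]
  · simp

/-- The star subalgebra of trigonometric polynomials. -/
def trigPolynomials (n : ℕ) : StarSubalgebra ℂ C(Torus n, ℂ) where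
  toSubalgebra := Algebra.adjoin ℂ (Set.range character)
  star_mem' := by
    change Algebra.adjoin ℂ (Set.range character) ≤ star (Algebra.adjoin ℂ (Set.range character))
    refine Algebra.adjoin_le ?_
    rintro _ ⟨m, rfl⟩
    refine Algebra.subset_adjoin ⟨-m, ?_⟩
    ext x
    simp only [character_neg, starRingEnd_apply, ContinuousMap.star_apply]

theorem trigPolynomials_toSubmodule (n : ℕ) :
    (trigPolynomials n).toSubalgebra.toSubmodule = Submodule.span ℂ (Set.range character) := by
  apply Algebra.adjoin_eq_span_of_subset
  refine .trans (fun x => Submonoid.closure_induction (fun _ => id) ⟨0, character_zero⟩ ?_)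
    Submodule.subset_span
  rintro _ _ _ _ ⟨m, rfl⟩ ⟨k, rfl⟩
  exact ⟨m + k, character_add_eq_mul m k⟩

theorem trigPolynomials_separatesPoints (n : ℕ) :
    (trigPolynomials n).toSubalgebra.SeparatesPoints := by
  intro x y hxy
  obtain ⟨i, hi⟩ := Function.ne_iff.mp hxy
  refine ⟨_, ⟨character (Pi.single i 1), Algebra.subset_adjoin ⟨Pi.single i 1, rfl⟩, rfl⟩, ?_⟩
  dsimp only
  rw [character_single, character_single, fourier_one, fourier_one]
  exact fun h => hi (AddCircle.injective_toCircle Real.two_pi_pos.ne' (Circle.ext h))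

theorem span_character_topologicalClosure (n : ℕ) :
    (Submodule.span ℂ (Set.range (character (n := n)))).topologicalClosure = ⊤ := by
  rw [← trigPolynomials_toSubmodule]
  exact congr_arg (Subalgebra.toSubmodule <| StarSubalgebra.toSubalgebra ·)
    (ContinuousMap.starSubalgebra_topologicalClosure_eq_top_of_separatesPoints _
      (trigPolynomials_separatesPoints n))

theorem span_ofContinuous_character_topologicalClosure (n : ℕ) :
    (Submodule.span ℂ (Set.range fun m : Fin n → ℤ => ofContinuous (character m))).topologicalClosure
      = ⊤ := by
  have h := (ContinuousMap.toLp_denseRange ℂ (volume : Measure (Torus n)) ℂ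
    (p := 2) (by norm_num)).topologicalClosure_map_submodule (span_character_topologicalClosure n)
  simp only [Submodule.map_span, ContinuousLinearMap.coe_coe, ← Set.range_comp,
    Function.comp_def] at h
  exact h

/-- An element of `L²(Tⁿ)` is determined by its Fourier coefficients. -/
theorem ext_coeff {u v : L2 n} (h : ∀ m, coeff u m = coeff v m) : u = v := by
  rw [← sub_eq_zero]
  have horth : ∀ m, inner ℂ (ofContinuous (character m)) (u - v) = 0 := by
    intro m
    have hc : ((1 / (2 * π) ^ n : ℝ) : ℂ) ≠ 0 := by
      have := Real.two_pi_pos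
      exact_mod_cast (by positivity : (1 / (2 * π) ^ n : ℝ) ≠ 0)
    have := h m
    rw [coeff_eq_inner, coeff_eq_inner] at this
    rw [inner_sub_right, mul_left_cancel₀ hc this, sub_self]
  have hmem : u - v ∈
      (Submodule.span ℂ (Set.range fun m : Fin n → ℤ => ofContinuous (character m)))ᗮ := by
    rw [Submodule.mem_orthogonal]
    intro w hw
    induction hw using Submodule.span_induction with
    | mem w hw => obtain ⟨m, rfl⟩ := hw; exact horth m
    | zero => exact inner_zero_left _
    | add w w' _ _ h1 h2 => rw [inner_add_left, h1, h2, add_zero]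
    | smul c w _ h1 => rw [inner_smul_left, h1, mul_zero]
  rw [← Submodule.orthogonal_closure, span_ofContinuous_character_topologicalClosure,
    Submodule.top_orthogonal_eq_bot] at hmem
  exact hmem

/-! ### Passage between functions and their Fourier coefficients -/

theorem coeff_add (u v : L2 n) (m : Fin n → ℤ) : coeff (u + v) m = coeff u m + coeff v m := by
  rw [coeff_eq_inner, coeff_eq_inner, coeff_eq_inner, inner_add_right, mul_add]

theorem coeff_sum {ι : Type*} (s : Finset ι) (u : ι → L2 n) (m : Fin n → ℤ) :
    coeff (∑ i ∈ s, u i) m = ∑ i ∈ s, coeff (u i) m := by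
  simp_rw [coeff_eq_inner, inner_sum, Finset.mul_sum]

/-- Bessel's inequality, with the factor `(2π)^{-n} ≤ 1` dropped. -/
theorem sum_norm_sq_coeff_le (u : L2 n) (F : Finset (Fin n → ℤ)) :
    ∑ m ∈ F, ‖coeff u m‖ ^ 2 ≤ ‖u‖ ^ 2 := by
  set q : ℝ := (2 * π) ^ n with hq
  have hq1 : 1 ≤ q := one_le_pow₀ (by linarith [Real.pi_gt_three])
  have hq0 : 0 < q := by linarith
  have ho : Orthonormal ℂ fun m : Fin n → ℤ =>
      ((1 / √q : ℝ) : ℂ) • ofContinuous (character m) := by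
    rw [orthonormal_iff_ite]
    intro m k
    rw [inner_smul_left, inner_smul_right, inner_character, ← hq]
    split_ifs
    · rw [Complex.conj_ofReal]
      norm_cast
      have := Real.mul_self_sqrt hq0.le
      have h0 := (Real.sqrt_pos.mpr hq0).ne'
      field_simp
      rw [sq, this]
    · simp
  refine le_trans (Finset.sum_le_sum fun m _ => ?_) (ho.sum_inner_products_le u (s := F))
  rw [coeff_eq_inner, ← hq, inner_smul_left, norm_mul, norm_mul, Complex.conj_ofReal,
    Complex.norm_real, Complex.norm_real, Real.norm_of_nonneg (by positivity),
    Real.norm_of_nonneg (by positivity), mul_pow, mul_pow, div_pow, div_pow, Real.sq_sqrt hq0.le]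
  gcongr
  nlinarith

theorem coeff_zero_eq_zero_of_average {g : L2 n} (hg : ⨍ x, g x = 0) : coeff g 0 = 0 := by
  have h : ∫ x, g x = 0 := by
    rw [average_eq, smul_eq_zero] at hg
    refine hg.resolve_left (inv_ne_zero ?_)
    rw [measureReal_def, ENNReal.toReal_ne_zero]
    refine ⟨?_, measure_ne_top _ _⟩
    exact isOpen_univ.measure_ne_zero _ Set.univ_nonempty
  simp [coeff, character_zero, h]

theorem sobolev_term_eq (x : sobolevCont n) (m : Freq n) :
    freqNorm m.1 ^ (2 * ((n : ℝ) / 2)) * ‖coeff (ofContinuous x.1.2) m‖ ^ 2 = ‖x.1.1 m‖ ^ 2 := by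
  have h := x.2 m
  have hN := Real.rpow_nonneg (freqNorm_nonneg m.1) ((n : ℝ) / 2)
  rw [h, norm_mul, mul_pow, Complex.norm_real, Real.norm_of_nonneg hN, coeffCLM_apply,
    ← Real.rpow_mul_natCast (freqNorm_nonneg m.1), mul_comm (2 : ℝ)]
  norm_num

theorem sobolev_term_support (hn : 1 ≤ n) (u : L2 n) :
    Function.support (fun m : Fin n → ℤ => freqNorm m ^ (2 * ((n : ℝ) / 2)) * ‖coeff u m‖ ^ 2) ⊆
      Set.range (Subtype.val : Freq n → Fin n → ℤ) := by
  intro m hm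
  refine ⟨⟨m, ?_⟩, rfl⟩
  rintro rfl
  refine hm ?_
  have : (n : ℝ) ≠ 0 := by positivity
  simp only [freqNorm_zero]
  rw [Real.zero_rpow (by positivity), zero_mul]

theorem hasSum_sobolev (hn : 1 ≤ n) (x : sobolevCont n) :
    HasSum (fun m : Fin n → ℤ => freqNorm m ^ (2 * ((n : ℝ) / 2)) *
      ‖coeff (ofContinuous x.1.2) m‖ ^ 2) (‖x.1.1‖ ^ 2) := by
  rw [← Subtype.val_injective.hasSum_iff fun m hm => ?_, FreqL2.norm_sq_eq]
  · exact x.1.1.summable_norm_sq.hasSum.congr_fun fun m => sobolev_term_eq x m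
  · by_contra h
    exact hm (sobolev_term_support hn _ h)

theorem memHomSobolev_sobolevCont (hn : 1 ≤ n) (x : sobolevCont n) :
    MemHomSobolev ((n : ℝ) / 2) (ofContinuous x.1.2) := (hasSum_sobolev hn x).summable

theorem norm_le_sobolevCont (hn : 1 ≤ n) (x : sobolevCont n) :
    homSobolevNorm ((n : ℝ) / 2) (ofContinuous x.1.2) + ‖x.1.2‖ ≤ 2 * ‖x‖ := by
  rw [homSobolevNorm, (hasSum_sobolev hn x).tsum_eq, Real.sqrt_sq (norm_nonneg _), two_mul ‖x‖]
  exact add_le_add (norm_fst_le x.1) (norm_snd_le x.1)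

theorem coeff_fracLaplacian_quarter {u : L2 n} (hu : MemHomSobolev ((n : ℝ) / 2) u)
    (m : Fin n → ℤ) : coeff (fracLaplacian ((n : ℝ) / 4) u) m =
      ((freqNorm m ^ ((n : ℝ) / 2) : ℝ) : ℂ) * coeff u m := by
  have h : 2 * ((n : ℝ) / 4) = n / 2 := by ring
  rw [coeff_fracLaplacian (by rwa [h]), h]

end TorusPDE

end

open TorusPDE in
theorem mainTheorem5 (n : ℕ) (hn : 1 ≤ n) :
    ∃ C : ℝ, 0 < C ∧ ∀ g : L2 n, ⨍ x, g x = 0 →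
      ∃ (f₀ : C(Torus n, ℂ)) (f : Fin n → C(Torus n, ℂ)),
        MemHomSobolev ((n : ℝ) / 2) (ofContinuous f₀) ∧
        (∀ j, MemHomSobolev ((n : ℝ) / 2) (ofContinuous (f j))) ∧
        g = fracLaplacian ((n : ℝ) / 4) (ofContinuous f₀) +
          ∑ j, fracLaplacian ((n : ℝ) / 4) (rieszConj j (ofContinuous (f j))) ∧
        (homSobolevNorm ((n : ℝ) / 2) (ofContinuous f₀) + ‖f₀‖) +
          ∑ j, (homSobolevNorm ((n : ℝ) / 2) (ofContinuous (f j)) + ‖f j‖) ≤ C * ‖g‖ := by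
  have hD : 0 < decompositionConst n := by
    have : (0 : ℝ) < n := by exact_mod_cast hn
    unfold decompositionConst
    positivity
  set c := √(decompositionConst n) with hc
  have hc0 : 0 < c := Real.sqrt_pos.mpr hD
  -- There are `n + 1` components, each with two norms bounded by its norm in the product space, and
  -- `2c` comes from the preimage bound.
  refine ⟨(n + 1) * (2 * (2 * c)), by positivity, fun g hg => ?_⟩
  let y : FreqL2 n := ⟨fun m => coeff g m.1,
    memℓp_two_of_summable ((summable_sq_coeff g).comp_injective Subtype.val_injective)⟩
  have hy : ‖y‖ ≤ ‖g‖ := by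
    refine (pow_le_pow_iff_left₀ (norm_nonneg _) (norm_nonneg _) two_ne_zero).mp ?_
    rw [FreqL2.norm_sq_eq]
    refine y.summable_norm_sq.tsum_le_of_sum_le fun F => ?_
    simpa [y] using sum_norm_sq_coeff_le g (F.map (Function.Embedding.subtype _))
  obtain ⟨x, hxy, hx⟩ :=
    exists_preimage_norm_le_of_dual_bound (system n) hc0 norm_le_mul_norm_comp_system y
  have hmem : ∀ i, MemHomSobolev ((n : ℝ) / 2) (ofContinuous (x i).1.2) :=
    fun i => memHomSobolev_sobolevCont hn (x i)
  refine ⟨(x none).1.2, fun j => (x (some j)).1.2, hmem none, fun j => hmem (some j), ?_, ?_⟩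
  · refine ext_coeff fun m => ?_
    rw [coeff_add, coeff_sum, coeff_fracLaplacian_quarter (hmem none)]
    simp_rw [fun j => coeff_fracLaplacian_quarter ((hmem (some j)).rieszConj j), coeff_rieszConj]
    -- `system` does not see the zero frequency: there `g` has coefficient `0` by its zero mean, and
    -- `|m|^{n/2}` vanishes because `n ≥ 1`.
    rcases eq_or_ne m 0 with rfl | hm
    · have : (n : ℝ) ≠ 0 := by positivity
      rw [coeff_zero_eq_zero_of_average hg, freqNorm_zero, Real.zero_rpow (by positivity)]
      simp
    · have h1 : coeff g m = system n x ⟨m, hm⟩ := by rw [hxy]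
      have h2 : ∀ i, (x i).1.1 ⟨m, hm⟩ =
          ((freqNorm m ^ ((n : ℝ) / 2) : ℝ) : ℂ) * coeff (ofContinuous (x i).1.2) m := fun i => by
        rw [← coeffCLM_apply]
        exact (x i).2 ⟨m, hm⟩
      rw [h1, system_apply, Fintype.sum_option]
      simp only [h2, systemSymbol, Option.elim, one_mul]
      congr 1
      exact Finset.sum_congr rfl fun j _ => mul_left_comm _ _ _
  · rw [← Fintype.sum_option (f := fun i =>
      homSobolevNorm ((n : ℝ) / 2) (ofContinuous (x i).1.2) + ‖(x i).1.2‖)]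
    calc ∑ i, (homSobolevNorm ((n : ℝ) / 2) (ofContinuous (x i).1.2) + ‖(x i).1.2‖)
        ≤ ∑ _i : Option (Fin n), 2 * ‖x‖ := Finset.sum_le_sum fun i _ =>
          (norm_le_sobolevCont hn (x i)).trans (by gcongr; exact norm_le_pi_norm x i)
      _ = (n + 1) * (2 * ‖x‖) := by simp
      _ ≤ (n + 1) * (2 * (2 * c * ‖g‖)) := by
          gcongr
          exact hx.trans (by gcongr)
      _ = (n + 1) * (2 * (2 * c)) * ‖g‖ := by ring
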